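/- Let $A$ be a $2\times 2$ integer matrix whose eigenvalues $\lambda_1,\lambda_2$ satisfy $0<|\lambda_1|<1<|\lambda_2|$, put $l_i=\log|\lambda_i|$ ($i=1,2$), and let $T(x)=Ax \bmod 1$ on the torus $\mathbb{T}^2=\mathbb{R}^2/\mathbb{Z}^2$ with its Euclidean quotient metric. Let $(z_n)$ be an arbitrary sequence of points of $\mathbb{T}^2$ and, for $\tau>0$, let \[ W_\tau=\{\,x\in\mathbb{T}^2 : T^n(x)\in B(z_n,e^{-n\tau})\text{ for infinitely many } n\in\mathbb{N}\,\}, \] where $B(z,r)$ denotes the open ball. For $\tau>0$ with $\tau\neq -l_1$ put \[ s_\tau=\begin{cases}\dfrac{2l_2}{\tau+l_2}, & 0<\tau<-l_1,\\[2ex] \min\Bigl\{\dfrac{l_1+l_2}{\tau+l_1},\dfrac{2l_2}{\tau+l_2}\Bigr\}, & \tau>-l_1.\end{cases} \] Then $\dim_{\mathrm H}W_\tau=s_\tau$. Moreover, $W_\tau$ belongs to Falconer's large intersection class $\mathscr{G}^{s_\tau}$. Here, for $s\ge 0$, $\mathscr{G}^{s}(\mathbb{R}^2)$ is the class of all $G_\delta$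 sets $F\subset\mathbb{R}^2$ such that $\dim_{\mathrm H}\bigcap_{i}f_i(F)\ge s$ for every sequence $(f_i)$ of similarity transformations of $\mathbb{R}^2$, and a set $E\subset\mathbb{T}^2$ belongs to $\mathscr{G}^{s}$ if its $\mathbb{Z}^2$-periodic lift to $\mathbb{R}^2$ belongs to $\mathscr{G}^{s}(\mathbb{R}^2)$. -/

import Mathlib

open Filter

noncomputable section

/-- The `d`-dimensional torus `ℝ^d / ℤ^d`. The distance is the quotient of the Euclidean one: the
square root of the sum of the squared circle distances of the coordinates. -/
abbrev Torus (d : ℕ) : Type := PiLp 2 (fun _ : Fin d => UnitAddCircle)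

/-- The quotient map `ℝ^d → ℝ^d / ℤ^d`. -/
def Torus.proj {d : ℕ} (x : EuclideanSpace ℝ (Fin d)) : Torus d :=
  WithLp.toLp 2 (fun i => (x i : UnitAddCircle))

/-- The toral endomorphism `T x = A x mod 1` of an integer matrix `A`. -/
def toralMap {d : ℕ} (A : Matrix (Fin d) (Fin d) ℤ) (x : Torus d) : Torus d :=
  WithLp.toLp 2 (fun i => ∑ j, A i j • x j)

/-- The set `W_τ` of the points `x` of the torus with `T^n x ∈ B(z_n, e^{-nτ})` for infinitely
many `n` (open balls). -/
def shrinkingTargetSet {d : ℕ} (A : Matrix (Fin d) (Fin d) ℤ) (z : ℕ → Torus d) (τ : ℝ) :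
    Set (Torus d) :=
  {x | ∃ᶠ n : ℕ in atTop, (toralMap A)^[n] x ∈ Metric.ball (z n) (Real.exp (-(n * τ)))}

/-- Falconer's class `𝒢^s(ℝ^d)` of sets with large intersections: the `G_δ` subsets `F` of `ℝ^d`
such that `⋂ i, f i (F)` has Hausdorff dimension at least `s` for every sequence `f` of
similarity transformations of `ℝ^d` (bijections of `ℝ^d` that multiply all distances by a
constant positive ratio). -/
def LargeIntersectionClass (d : ℕ) (s : ℝ) : Set (Set (EuclideanSpace ℝ (Fin d))) :=
  {F | IsGδ F ∧
    ∀ f : ℕ → (EuclideanSpace ℝ (Fin d) ≃ᵈ EuclideanSpace ℝ (Fin d)),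
      ENNReal.ofReal s ≤ dimH (⋂ i, f i '' F)}

/-- Falconer's class `𝒢^s` on the torus: the sets whose `ℤ^d`-periodic lift to `ℝ^d` belongs to
`𝒢^s(ℝ^d)`. -/
def TorusLargeIntersectionClass (d : ℕ) (s : ℝ) : Set (Set (Torus d)) :=
  {E | Torus.proj ⁻¹' E ∈ LargeIntersectionClass d s}

end

/-!
The eigenvalues `a₁`, `a₂` of `A` are real and irrational. The lower bound rests on a large
intersection principle, `IsFrostmanSequence.le_dimH_iInter`: let `ψ n ≥ 0` be continuous densities
that converge weakly to Lebesgue measure and satisfy `∫_{B(x, r)} ψ n ≤ C r ^ s` with the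
same `C` for all `n`. Then the limsup of their supports has dimension at least `s`, and so has the
intersection of countably many sets of this kind: multiplying a test density by a late `ψ n` changes
its mass and its Frostman constant of exponent `t < s` very little, so infinitely many factors,
taken in turn from all the sequences, leave a compact set on which a Frostman bound survives.
Similarities preserve the hypothesis, which turns the bound for one set into membership in
Falconer's class. It is applied to normalized tent functions on balls around `z n` of radius
`e^{-nτ} / 2`, pulled back under `T^n`.

The Frostman bound is the estimate `IsHyperbolicPair.exists_volume_inter_le` for the area in which
`T^{-n} B(z, ρ)` meets a ball of radius `r`. The preimage consists of parallelograms along the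
eigendirections, one for each point of a translated lattice. In eigencoordinates the lattice points
that matter lie in a rectangle, and the product of the eigencoordinates of a nonzero lattice vector
is a nonzero integer (`one_le_abs_eigenform_mul`), so their number is at most a constant times the
area of the rectangle plus `2`. The exponent for which this area is `O(e^{-2nτ} r ^ s)` is
`targetDim`.

Weak convergence is a statement about Fourier coefficients, `IsHyperbolicPair.tendsto_fourier`. If
`|det A| ≥ 2`, every nontrivial character is eventually nontrivial on the kernel of `T^n`, which
leaves the densities invariant. If `|det A| = 1` and `τ < -l₁`, the densities are almost invariant
under translations along the contracting direction. If `|det A| = 1` and `τ > -l₁`, the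
exponent is zero and only the `G_δ` property remains.

For the upper bound, the same parallelograms give efficient covers. A separated subset of
`T^{-n} B(z, e^{-nτ})` at scale `e^{-n(τ + l)}` carries disjoint parallelograms inside a slightly
larger preimage, whose area is known, so its cardinality is bounded
(`IsHyperbolicPair.exists_cover`). The scales given by `l = l₂` and `l = l₁` yield the two terms of
the minimum.
-/

noncomputable section

open MeasureTheory Topology Set
open scoped ENNReal NNReal

/-- A sequence of densities `ψ n` with respect to `μ` that satisfies a Frostman condition of
exponent `s` uniformly in `n` (at scales bounded by any given `R`) and converges to `μ` when tested
against continuous functions of compact support. -/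
structure IsFrostmanSequence {E : Type*} [PseudoMetricSpace E] [MeasurableSpace E]
    (μ : Measure E) (s : ℝ) (ψ : ℕ → E → ℝ) : Prop where
  continuous : ∀ n, Continuous (ψ n)
  nonneg : ∀ n x, 0 ≤ ψ n x
  frostman : ∀ R : ℝ, ∃ C : ℝ, ∀ n x r, 0 < r → r ≤ R →
    ∫ y in Metric.closedBall x r, ψ n y ∂μ ≤ C * r ^ s
  tendsto : ∀ φ : E → ℝ, Continuous φ → HasCompactSupport φ →
    Tendsto (fun n => ∫ x, φ x * ψ n x ∂μ) atTop (𝓝 (∫ x, φ x ∂μ))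

/-! ### Covers by balls -/

section Covering

/-- A set of zero Hausdorff measure has countable coverings by balls with arbitrarily small sums of
powers of the radii. -/
theorem exists_cover_balls_of_hausdorffMeasure_eq_zero {E : Type*} [MetricSpace E]
    [MeasurableSpace E] [BorelSpace E] {t : ℝ} (ht : 0 < t) {K : Set E} (hK : K.Nonempty)
    (h : μH[t] K = 0) {ε : ℝ} (hε : 0 < ε) :
    ∃ (x : ℕ → E) (r : ℕ → ℝ), (∀ j, x j ∈ K) ∧ (∀ j, 0 < r j ∧ r j ≤ 1) ∧
      K ⊆ ⋃ j, Metric.ball (x j) (r j) ∧ ∀ F : Finset ℕ, ∑ j ∈ F, r j ^ t ≤ ε := by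
  obtain ⟨p, hp⟩ := hK
  rw [Measure.hausdorffMeasure_apply] at h
  have h1 := (ENNReal.iSup_eq_zero.1 ((ENNReal.iSup_eq_zero.1 h) (ENNReal.ofReal (1/2))))
    (by simp)
  have hlt : (⨅ (T : ℕ → Set E) (_ : K ⊆ ⋃ n, T n)
      (_ : ∀ n, Metric.ediam (T n) ≤ ENNReal.ofReal (1/2)),
          ∑' n, ⨆ _ : (T n).Nonempty, Metric.ediam (T n) ^ t) < ENNReal.ofReal (ε / 2) := by
    rw [h1]; simpa using hε
  simp only [iInf_lt_iff] at hlt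
  obtain ⟨T, hKT, hdiam, hsum⟩ := hlt
  obtain ⟨e, he0, hes⟩ : ∃ e : ℕ → ℝ, (∀ j, 0 < e j) ∧ ∀ F : Finset ℕ, ∑ j ∈ F, e j ≤ ε / 2 := by
    obtain ⟨e, he, c, hc, hcε⟩ := posSumOfEncodable (half_pos hε) ℕ
    exact ⟨e, he, fun F => (sum_le_hasSum F (fun i _ => (he i).le) hc).trans hcε⟩
  -- the diameter of the `j`-th piece, slightly enlarged
  have hr : ∀ j, ∃ r : ℝ, (Metric.ediam (T j)).toReal < r ∧ r ≤ 1 ∧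
      r ^ t ≤ (Metric.ediam (T j)).toReal ^ t + e j := by
    intro j
    set d := (Metric.ediam (T j)).toReal with hd
    have hd1 : d < 1 := by
      have := ENNReal.toReal_mono (by simp) (hdiam j)
      rw [ENNReal.toReal_ofReal (by norm_num)] at this
      linarith
    have hc : Tendsto (fun r : ℝ => r ^ t) (𝓝[>] d) (𝓝 (d ^ t)) :=
      ((Real.continuousAt_rpow_const d t (Or.inr ht.le)).tendsto).mono_left nhdsWithin_le_nhds
    have h2 := hc.eventually (ge_mem_nhds (show d ^ t < d ^ t + e j by linarith [he0 j]))
    obtain ⟨r, hr1, hr2, hr3⟩ := (h2.and ((Ioc_mem_nhdsGT hd1))).exists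
    exact ⟨r, hr2, hr3, hr1⟩
  choose r hr1 hr2 hr3 using hr
  have hx : ∀ j, ∃ x ∈ K, (T j ∩ K).Nonempty → x ∈ T j := by
    intro j
    by_cases hj : (T j ∩ K).Nonempty
    · obtain ⟨x, hx1, hx2⟩ := hj
      exact ⟨x, hx2, fun _ => hx1⟩
    · exact ⟨p, hp, fun h => absurd h hj⟩
  choose x hxK hxT using hx
  have hr0 : ∀ j, 0 < r j := fun j => ENNReal.toReal_nonneg.trans_lt (hr1 j)
  refine ⟨x, r, hxK, fun j => ⟨hr0 j, hr2 j⟩, fun y hy => ?_, fun F => ?_⟩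
  · obtain ⟨j, hj⟩ := mem_iUnion.1 (hKT hy)
    refine mem_iUnion.2 ⟨j, lt_of_le_of_lt ?_ (hr1 j)⟩
    exact Metric.dist_le_diam_of_mem' (ne_top_of_le_ne_top (by simp) (hdiam j)) hj
      (hxT j ⟨y, hj, hy⟩)
  · have key : ∀ j, ENNReal.ofReal (r j ^ t) ≤
        (⨆ _ : (T j).Nonempty, Metric.ediam (T j) ^ t) + ENNReal.ofReal (e j) := by
      intro j
      refine (ENNReal.ofReal_le_ofReal (hr3 j)).trans (ENNReal.ofReal_add_le.trans ?_)
      gcongr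
      rw [← ENNReal.ofReal_rpow_of_nonneg ENNReal.toReal_nonneg ht.le,
        ENNReal.ofReal_toReal (ne_top_of_le_ne_top (by simp) (hdiam j))]
      by_cases hj : (T j).Nonempty
      · exact le_iSup (fun _ : (T j).Nonempty => Metric.ediam (T j) ^ t) hj
      · simp [not_nonempty_iff_eq_empty.1 hj, ht]
    have : ENNReal.ofReal (∑ j ∈ F, r j ^ t) ≤ ENNReal.ofReal ε := by
      rw [ENNReal.ofReal_sum_of_nonneg (fun j _ => Real.rpow_nonneg (hr0 j).le _)]
      refine (Finset.sum_le_sum fun j _ => key j).trans ?_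
      rw [Finset.sum_add_distrib, ← ENNReal.ofReal_sum_of_nonneg (fun j _ => (he0 j).le)]
      calc _ ≤ ENNReal.ofReal (ε / 2) + ENNReal.ofReal (ε / 2) := by
            gcongr
            · exact (ENNReal.sum_le_tsum F).trans hsum.le
            · exact hes F
        _ = ENNReal.ofReal ε := by
            rw [← ENNReal.ofReal_add (by positivity) (by positivity), add_halves]
    exact (ENNReal.ofReal_le_ofReal_iff hε.le).1 this

end Covering

/-! ### Limit sets of Frostman sequences -/

section Construction

variable {E : Type*} [MetricSpace E]

/-- A continuous cutoff function, equal to `1` on the ball of radius `2 * δ` around `y` and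
vanishing outside the ball of radius `3 * δ`. -/
def ballCutoff (δ : ℝ) (y x : E) : ℝ := max 0 (min 1 (3 - dist x y / δ))

theorem continuous_ballCutoff (δ : ℝ) (y : E) : Continuous (ballCutoff δ y) := by
  unfold ballCutoff; fun_prop

theorem ballCutoff_nonneg (δ : ℝ) (y x : E) : 0 ≤ ballCutoff δ y x := le_max_left _ _

theorem ballCutoff_le_one (δ : ℝ) (y x : E) : ballCutoff δ y x ≤ 1 :=
  max_le zero_le_one (min_le_left _ _)

theorem ballCutoff_eq_one {δ : ℝ} (hδ : 0 < δ) {y x : E} (h : dist x y ≤ 2 * δ) :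
    ballCutoff δ y x = 1 := by
  have : dist x y / δ ≤ 2 := (div_le_iff₀ hδ).2 h
  rw [ballCutoff, min_eq_left (by linarith), max_eq_right zero_le_one]

theorem ballCutoff_eq_zero {δ : ℝ} (hδ : 0 < δ) {y x : E} (h : 3 * δ < dist x y) :
    ballCutoff δ y x = 0 := by
  have : 3 < dist x y / δ := (lt_div_iff₀ hδ).2 h
  exact max_eq_left ((min_le_right _ _).trans (by linarith))

variable [MeasurableSpace E] [BorelSpace E] {μ : Measure E} [IsFiniteMeasureOnCompacts μ]
  {s t : ℝ} {ψ : ℕ → E → ℝ} {φ : E → ℝ}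

theorem IsFrostmanSequence.integral_cutoff_mul_le [ProperSpace E] (hψ : IsFrostmanSequence μ s ψ)
    (hφ : Continuous φ) (hφ0 : ∀ x, 0 ≤ φ x) (hφc : HasCompactSupport φ) :
    ∃ C, 0 ≤ C ∧ ∀ n y δ, 0 < δ → δ ≤ 1 →
      ∫ x, ballCutoff δ y x * φ x * ψ n x ∂μ ≤ C * δ ^ s := by
  obtain ⟨C, hC⟩ := hψ.frostman 3
  obtain ⟨M, hM⟩ := hφc.exists_bound_of_continuous hφ
  have hM' : ∀ x, φ x ≤ max M 0 := fun x =>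
    (le_abs_self _).trans ((hM x).trans (le_max_left _ _))
  refine ⟨max M 0 * (max C 0 * 3 ^ s), by positivity, fun n y δ hδ hδ1 => ?_⟩
  have hint : IntegrableOn (ψ n) (Metric.closedBall y (3 * δ)) μ :=
    (hψ.continuous n).continuousOn.integrableOn_compact (isCompact_closedBall _ _)
  calc ∫ x, ballCutoff δ y x * φ x * ψ n x ∂μ
      ≤ ∫ x, (Metric.closedBall y (3 * δ)).indicator (fun x => max M 0 * ψ n x) x ∂μ := by
        refine integral_mono_of_nonneg (ae_of_all _ fun x => ?_) ?_ (ae_of_all _ fun x => ?_)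
        · exact mul_nonneg (mul_nonneg (ballCutoff_nonneg _ _ _) (hφ0 x)) (hψ.nonneg n x)
        · exact (integrable_indicator_iff Metric.isClosed_closedBall.measurableSet).2
            (hint.const_mul _)
        · by_cases hx : x ∈ Metric.closedBall y (3 * δ)
          · rw [indicator_of_mem hx]
            have h1 := ballCutoff_le_one δ y x
            have h0 := ballCutoff_nonneg δ y x
            have : ballCutoff δ y x * φ x ≤ 1 * max M 0 :=
              mul_le_mul h1 (hM' x) (hφ0 x) zero_le_one
            rw [one_mul] at this
            exact mul_le_mul_of_nonneg_right this (hψ.nonneg n x)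
          · rw [indicator_of_notMem hx]
            rw [Metric.mem_closedBall, not_le] at hx
            simp [ballCutoff_eq_zero hδ hx]
    _ = max M 0 * ∫ x in Metric.closedBall y (3 * δ), ψ n x ∂μ := by
        rw [integral_indicator Metric.isClosed_closedBall.measurableSet, integral_const_mul]
    _ ≤ max M 0 * (max C 0 * (3 * δ) ^ s) := by
        refine mul_le_mul_of_nonneg_left ?_ (le_max_right _ _)
        refine (hC n y (3 * δ) (by positivity) (by linarith)).trans ?_
        exact mul_le_mul_of_nonneg_right (le_max_left _ _) (by positivity)
    _ = _ := by rw [Real.mul_rpow (by norm_num) hδ.le]; ring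

theorem IsFrostmanSequence.integral_cutoff_le [ProperSpace E] (hψ : IsFrostmanSequence μ s ψ)
    (hφ : Continuous φ) (hφ0 : ∀ x, 0 ≤ φ x) (hφc : HasCompactSupport φ) :
    ∃ C, 0 ≤ C ∧ ∀ y δ, 0 < δ → δ ≤ 1 → ∫ x, ballCutoff δ y x * φ x ∂μ ≤ C * δ ^ s := by
  obtain ⟨C, hC0, hC⟩ := hψ.integral_cutoff_mul_le hφ hφ0 hφc
  refine ⟨C, hC0, fun y δ hδ hδ1 => ?_⟩
  exact le_of_tendsto (hψ.tendsto (fun x => ballCutoff δ y x * φ x)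
    ((continuous_ballCutoff δ y).mul hφ) hφc.mul_left)
    (Eventually.of_forall fun n => hC n y δ hδ hδ1)

/-- Multiplying a test density by a late member of a Frostman sequence changes its mass and its
Frostman constant by arbitrarily little: at small scales the uniform bound of larger exponent `s`
wins, and only finitely many cutoffs of larger scale remain, to which convergence applies. -/
theorem IsFrostmanSequence.eventually_mul [ProperSpace E] (hψ : IsFrostmanSequence μ s ψ)
    (hts : t < s) (hφ : Continuous φ) (hφ0 : ∀ x, 0 ≤ φ x) (hφc : HasCompactSupport φ)
    (N : ℕ → Finset E) {C : ℝ} (hC0 : 0 ≤ C)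
    (hC : ∀ m, ∀ y ∈ N m, ∫ x, ballCutoff ((1 / 2) ^ m) y x * φ x ∂μ ≤ C * ((1 / 2 : ℝ) ^ m) ^ t)
    {ε : ℝ} (hε : 0 < ε) :
    ∀ᶠ n in atTop, ∫ x, φ x ∂μ - ε ≤ ∫ x, φ x * ψ n x ∂μ ∧
      ∀ m, ∀ y ∈ N m, ∫ x, ballCutoff ((1 / 2) ^ m) y x * (φ x * ψ n x) ∂μ ≤
        (C + ε) * ((1 / 2 : ℝ) ^ m) ^ t := by
  obtain ⟨C', hC'0, hC'⟩ := hψ.integral_cutoff_mul_le hφ hφ0 hφc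
  have hδ0 : ∀ m : ℕ, 0 < (1 / 2 : ℝ) ^ m := fun m => by positivity
  have hδ1 : ∀ m : ℕ, (1 / 2 : ℝ) ^ m ≤ 1 := fun m => pow_le_one₀ (by norm_num) (by norm_num)
  have hlim : Tendsto (fun m : ℕ => C' * ((1 / 2 : ℝ) ^ m) ^ (s - t)) atTop (𝓝 0) := by
    have h1 : Tendsto (fun m : ℕ => (1 / 2 : ℝ) ^ m) atTop (𝓝 0) :=
      tendsto_pow_atTop_nhds_zero_of_lt_one (by norm_num) (by norm_num)
    have h2 := (h1.rpow_const (p := s - t) (Or.inr (by linarith))).const_mul C'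
    rwa [Real.zero_rpow (by linarith), mul_zero] at h2
  obtain ⟨m₀, hm₀⟩ := eventually_atTop.1 (hlim.eventually (ge_mem_nhds hε))
  have hsmall : ∀ n, ∀ m ≥ m₀, ∀ y, ∫ x, ballCutoff ((1 / 2) ^ m) y x * (φ x * ψ n x) ∂μ ≤
      (C + ε) * ((1 / 2 : ℝ) ^ m) ^ t := by
    intro n m hm y
    simp_rw [← mul_assoc]
    refine (hC' n y _ (hδ0 m) (hδ1 m)).trans ?_
    have h1 : ((1 / 2 : ℝ) ^ m) ^ s = ((1 / 2 : ℝ) ^ m) ^ (s - t) * ((1 / 2 : ℝ) ^ m) ^ t := by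
      rw [← Real.rpow_add (hδ0 m)]; congr 1; ring
    rw [h1, ← mul_assoc]
    refine mul_le_mul_of_nonneg_right ((hm₀ m hm).trans (by linarith)) ?_
    exact Real.rpow_nonneg (hδ0 m).le _
  have hlarge : ∀ᶠ n in atTop, ∀ m ∈ Finset.range m₀, ∀ y ∈ N m,
      ∫ x, ballCutoff ((1 / 2) ^ m) y x * (φ x * ψ n x) ∂μ ≤ (C + ε) * ((1 / 2 : ℝ) ^ m) ^ t := by
    rw [Finset.eventually_all]
    intro m _
    rw [Finset.eventually_all]
    intro y hy
    have h1 := hψ.tendsto (fun x => ballCutoff ((1 / 2) ^ m) y x * φ x)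
      ((continuous_ballCutoff _ y).mul hφ) hφc.mul_left
    have hlt : ∫ x, ballCutoff ((1 / 2) ^ m) y x * φ x ∂μ < (C + ε) * ((1 / 2 : ℝ) ^ m) ^ t := by
      refine (hC m y hy).trans_lt ?_
      exact mul_lt_mul_of_pos_right (by linarith) (Real.rpow_pos_of_pos (hδ0 m) _)
    filter_upwards [h1.eventually (ge_mem_nhds hlt)] with n hn
    simpa only [← mul_assoc] using hn
  have hmass := (hψ.tendsto φ hφ hφc).eventually
    (le_mem_nhds (show ∫ x, φ x ∂μ - ε < ∫ x, φ x ∂μ by linarith))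
  filter_upwards [hlarge, hmass] with n hn1 hn2
  refine ⟨hn2, fun m y hy => ?_⟩
  rcases lt_or_ge m m₀ with h | h
  · exact hn1 m (Finset.mem_range.2 h) y hy
  · exact hsmall n m h y

/-- The large intersection principle: if each `ψ i` is a Frostman sequence of exponent `s`, the
points that lie, for every `i`, in the supports of infinitely many `ψ i n` form a set of Hausdorff
dimension at least `s`. The points are found in the supports of products of late members of the
sequences, along which a Frostman bound of exponent `t < s` persists. -/
theorem IsFrostmanSequence.le_dimH_iInter [ProperSpace E] [Nonempty E] [μ.IsOpenPosMeasure]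
    {ψ : ℕ → ℕ → E → ℝ} (hψ : ∀ i, IsFrostmanSequence μ s (ψ i)) :
    ENNReal.ofReal s ≤ dimH (⋂ i, {x | ∃ᶠ n in atTop, x ∈ tsupport (ψ i n)}) := by
  set W : Set E := ⋂ i, {x | ∃ᶠ n in atTop, x ∈ tsupport (ψ i n)} with hW
  refine le_of_forall_lt fun c hc => ?_
  obtain ⟨t, hct, hts⟩ := ENNReal.lt_iff_exists_nnreal_btwn.1 hc
  refine hct.trans_le ?_
  have ht0 : (0 : ℝ) < t := by
    have : (0 : ℝ≥0∞) < t := zero_le.trans_lt hct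
    exact_mod_cast this
  replace hts : (t : ℝ) < s := by
    rw [← ENNReal.ofReal_coe_nnreal] at hts
    exact (ENNReal.ofReal_lt_ofReal_iff'.1 hts).1
  clear hct hc c
  -- the initial density
  obtain ⟨p⟩ := ‹Nonempty E›
  let φ₀ : E → ℝ := ballCutoff 1 p
  have hφ₀ : Continuous φ₀ := continuous_ballCutoff 1 p
  have hφ₀0 : ∀ x, 0 ≤ φ₀ x := ballCutoff_nonneg 1 p
  have hφ₀c : HasCompactSupport φ₀ := by
    refine HasCompactSupport.intro (isCompact_closedBall p 3) fun x hx => ?_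
    refine ballCutoff_eq_zero one_pos ?_
    simpa using hx
  have hM : 0 < ∫ x, φ₀ x ∂μ := by
    refine hφ₀.integral_pos_of_hasCompactSupport_nonneg_nonzero hφ₀c hφ₀0 (x := p) ?_
    rw [show φ₀ p = 1 from ballCutoff_eq_one one_pos (by simp)]
    exact one_ne_zero
  set M := ∫ x, φ₀ x ∂μ with hMdef
  obtain ⟨C, hC0, hC⟩ := (hψ 0).integral_cutoff_le hφ₀ hφ₀0 hφ₀c
  -- finite nets of the support at all dyadic scales
  have hnet : ∀ m : ℕ, ∃ N : Finset E, ∀ x ∈ tsupport φ₀, ∃ y ∈ N, dist x y < (1 / 2 : ℝ) ^ m := by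
    intro m
    obtain ⟨N, -, hN1, hN2⟩ := hφ₀c.isCompact.finite_cover_balls
      (show (0 : ℝ) < (1 / 2) ^ m by positivity)
    refine ⟨hN1.toFinset, fun x hx => ?_⟩
    obtain ⟨y, hy, hxy⟩ := mem_iUnion₂.1 (hN2 hx)
    exact ⟨y, hN1.mem_toFinset.2 hy, hxy⟩
  choose N hN using hnet
  -- the property maintained in the construction
  let Q : ℕ → (E → ℝ) → Prop := fun k φ => Continuous φ ∧ (∀ x, 0 ≤ φ x) ∧ HasCompactSupport φ ∧
    M / 2 * (1 + (1 / 2) ^ k) ≤ ∫ x, φ x ∂μ ∧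
    ∀ m, ∀ y ∈ N m, ∫ x, ballCutoff ((1 / 2) ^ m) y x * φ x ∂μ ≤
      (C + 1 - (1 / 2) ^ k) * ((1 / 2 : ℝ) ^ m) ^ (t : ℝ)
  have hQ0 : Q 0 φ₀ := by
    refine ⟨hφ₀, hφ₀0, hφ₀c, by norm_num; exact hMdef.le, fun m y _ => ?_⟩
    have h1 : (0 : ℝ) < (1 / 2) ^ m := by positivity
    have h2 : (1 / 2 : ℝ) ^ m ≤ 1 := pow_le_one₀ (by norm_num) (by norm_num)
    refine (hC y _ h1 h2).trans ?_
    rw [pow_zero, add_sub_cancel_right]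
    exact mul_le_mul_of_nonneg_left (Real.rpow_le_rpow_of_exponent_ge h1 h2 hts.le) hC0
  have hstep : ∀ k (φ : {φ // Q k φ}), ∃ φ' : {φ // Q (k + 1) φ}, ∃ n ≥ k,
      φ'.1 = fun x => φ.1 x * ψ (Nat.unpair k).1 n x := by
    rintro k ⟨φ, h1, h2, h3, h4, h5⟩
    have hk1 : (1 / 2 : ℝ) ^ k ≤ 1 := pow_le_one₀ (by norm_num) (by norm_num)
    have hk0 : 0 < (1 / 2 : ℝ) ^ k := by positivity
    have hε : 0 < min (M / 2) 1 * (1 / 2) ^ (k + 1) := by positivity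
    obtain ⟨n, ⟨hn1, hn2⟩, hnk⟩ := (((hψ (Nat.unpair k).1).eventually_mul hts h1 h2 h3 N
      (by linarith) h5 hε).and (eventually_ge_atTop k)).exists
    refine ⟨⟨fun x => φ x * ψ (Nat.unpair k).1 n x, h1.mul ((hψ _).continuous n),
      fun x => mul_nonneg (h2 x) ((hψ _).nonneg n x), h3.mul_right, ?_, ?_⟩, n, hnk, rfl⟩
    · refine le_trans ?_ hn1
      have : min (M / 2) 1 * (1 / 2) ^ (k + 1) ≤ M / 2 * (1 / 2) ^ (k + 1) :=
        mul_le_mul_of_nonneg_right (min_le_left _ _) (by positivity)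
      rw [pow_succ] at this ⊢
      linarith
    · intro m y hy
      refine (hn2 m y hy).trans (mul_le_mul_of_nonneg_right ?_ (by positivity))
      have : min (M / 2) 1 * (1 / 2) ^ (k + 1) ≤ 1 * (1 / 2) ^ (k + 1) :=
        mul_le_mul_of_nonneg_right (min_le_right _ _) (by positivity)
      rw [pow_succ] at this ⊢
      linarith
  choose next hnext using hstep
  let seq : ∀ k, {φ // Q k φ} := fun k => Nat.rec ⟨φ₀, hQ0⟩ (fun k φ => next k φ) k
  have hseq : ∀ k, ∃ n ≥ k, (seq (k + 1)).1 = fun x => (seq k).1 x * ψ (Nat.unpair k).1 n x :=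
    fun k => hnext k (seq k)
  have hanti : ∀ k, tsupport (seq (k + 1)).1 ⊆ tsupport (seq k).1 := by
    intro k
    obtain ⟨n, -, hn⟩ := hseq k
    rw [hn]
    exact tsupport_mul_subset_left
  have hanti' : Antitone fun k => tsupport (seq k).1 := antitone_nat_of_succ_le hanti
  set K := ⋂ k, tsupport (seq k).1 with hK
  have hKW : K ⊆ W := by
    intro x hx
    refine mem_iInter.2 fun i => frequently_atTop.2 fun b => ?_
    obtain ⟨n, hn1, hn2⟩ := hseq (Nat.pair i b)
    refine ⟨n, (Nat.right_le_pair i b).trans hn1, ?_⟩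
    have h1 := mem_iInter.1 hx (Nat.pair i b + 1)
    rw [hn2, Nat.unpair_pair] at h1
    exact tsupport_mul_subset_right h1
  have hmass : ∀ k, M / 2 < ∫ x, (seq k).1 x ∂μ := by
    intro k
    refine lt_of_lt_of_le ?_ (seq k).2.2.2.2.1
    have : 0 < M / 2 * (1 / 2) ^ k := by positivity
    linarith
  have hKne : K.Nonempty := by
    refine IsCompact.nonempty_iInter_of_sequence_nonempty_isCompact_isClosed _ hanti ?_
      (seq 0).2.2.2.1.isCompact fun k => isClosed_tsupport _
    intro k
    by_contra h
    rw [not_nonempty_iff_eq_empty, tsupport_eq_empty_iff] at h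
    have := hmass k
    rw [h] at this
    simp at this
    linarith
  refine (le_dimH_of_hausdorffMeasure_ne_zero fun h0 => ?_).trans (dimH_mono hKW)
  -- a covering with small sum is impossible
  have hε : 0 < M / 4 / ((C + 1) * 2 ^ (t : ℝ)) := by positivity
  obtain ⟨x, r, hxK, hr, hcov, hsum⟩ :=
    exists_cover_balls_of_hausdorffMeasure_eq_zero ht0 hKne h0 hε
  have hball : ∀ k j, ∫ y in Metric.ball (x j) (r j), (seq k).1 y ∂μ ≤
      (C + 1) * 2 ^ (t : ℝ) * r j ^ (t : ℝ) := by
    intro k j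
    obtain ⟨m, hm1, hm2⟩ := exists_nat_pow_near_of_lt_one (hr j).1 (hr j).2
      (show (0 : ℝ) < 1 / 2 by norm_num) (by norm_num)
    obtain ⟨y, hy, hxy⟩ := hN m (x j) (mem_iInter.1 (hxK j) 0)
    have hδ : (0 : ℝ) < (1 / 2) ^ m := by positivity
    have hcont := (seq k).2.1
    have hcpt := (seq k).2.2.2.1
    have hnn := (seq k).2.2.1
    have hint : Integrable (seq k).1 μ := hcont.integrable_of_hasCompactSupport hcpt
    calc ∫ z in Metric.ball (x j) (r j), (seq k).1 z ∂μ
        ≤ ∫ z, ballCutoff ((1 / 2) ^ m) y z * (seq k).1 z ∂μ := by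
          rw [← integral_indicator Metric.isOpen_ball.measurableSet]
          refine integral_mono_of_nonneg (ae_of_all _ fun z => ?_) ?_ (ae_of_all _ fun z => ?_)
          · exact indicator_nonneg (fun z _ => hnn z) z
          · exact ((continuous_ballCutoff _ y).mul hcont).integrable_of_hasCompactSupport
              hcpt.mul_left
          · by_cases hz : z ∈ Metric.ball (x j) (r j)
            · rw [indicator_of_mem hz]
              dsimp only
              rw [ballCutoff_eq_one hδ, one_mul]
              have := Metric.mem_ball.1 hz
              have := dist_triangle z (x j) y
              linarith
            · rw [indicator_of_notMem hz]
              exact mul_nonneg (ballCutoff_nonneg _ _ _) (hnn z)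
      _ ≤ (C + 1 - (1 / 2) ^ k) * ((1 / 2 : ℝ) ^ m) ^ (t : ℝ) := (seq k).2.2.2.2.2 m y hy
      _ ≤ (C + 1) * (2 * r j) ^ (t : ℝ) := by
          have : (0 : ℝ) < (1 / 2) ^ k := by positivity
          refine mul_le_mul (by linarith) (Real.rpow_le_rpow hδ.le ?_ ht0.le) (by positivity)
            (by linarith)
          rw [pow_succ] at hm1
          linarith
      _ = _ := by rw [Real.mul_rpow (by norm_num) (hr j).1.le]; ring
  obtain ⟨k, F, hF⟩ : ∃ k, ∃ F : Finset ℕ, tsupport (seq k).1 ⊆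
      ⋃ j ∈ F, Metric.ball (x j) (r j) := by
    obtain ⟨k, hk⟩ := exists_subset_nhds_of_isCompact' (V := fun k => tsupport (seq k).1)
      (directed_of_isDirected_le fun a b hab => hanti' hab)
      (fun k => (seq k).2.2.2.1.isCompact) (fun k => isClosed_tsupport _)
      (U := ⋃ j, Metric.ball (x j) (r j))
      (fun z hz => (isOpen_iUnion fun j => Metric.isOpen_ball).mem_nhds (hcov hz))
    obtain ⟨F, hF⟩ := (seq k).2.2.2.1.isCompact.elim_finite_subcover
      (fun j => Metric.ball (x j) (r j)) (fun j => Metric.isOpen_ball) hk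
    exact ⟨k, F, hF⟩
  have hcont := (seq k).2.1
  have hcpt := (seq k).2.2.2.1
  have hnn := (seq k).2.2.1
  have hint : Integrable (seq k).1 μ := hcont.integrable_of_hasCompactSupport hcpt
  have hle : ∫ z, (seq k).1 z ∂μ ≤ ∑ j ∈ F, ∫ z in Metric.ball (x j) (r j), (seq k).1 z ∂μ := by
    simp_rw [← integral_indicator Metric.isOpen_ball.measurableSet]
    rw [← integral_finsetSum _ fun j _ => hint.indicator Metric.isOpen_ball.measurableSet]
    refine integral_mono hint
      (integrable_finsetSum _ fun j _ => hint.indicator Metric.isOpen_ball.measurableSet)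
      fun z => ?_
    have hind : ∀ j, 0 ≤ (Metric.ball (x j) (r j)).indicator (seq k).1 z :=
      fun j => indicator_nonneg (fun z _ => hnn z) z
    by_cases hz : z ∈ tsupport (seq k).1
    · obtain ⟨j, hj, hzj⟩ := mem_iUnion₂.1 (hF hz)
      calc (seq k).1 z = (Metric.ball (x j) (r j)).indicator (seq k).1 z :=
            (indicator_of_mem hzj _).symm
        _ ≤ _ := Finset.single_le_sum
            (f := fun j => (Metric.ball (x j) (r j)).indicator (seq k).1 z)
            (fun j _ => hind j) hj
    · rw [image_eq_zero_of_notMem_tsupport hz]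
      exact Finset.sum_nonneg fun j _ => hind j
  have h1 : ∑ j ∈ F, ∫ z in Metric.ball (x j) (r j), (seq k).1 z ∂μ ≤ M / 4 := by
    refine (Finset.sum_le_sum fun j _ => hball k j).trans ?_
    rw [← Finset.mul_sum]
    calc _ ≤ (C + 1) * 2 ^ (t : ℝ) * (M / 4 / ((C + 1) * 2 ^ (t : ℝ))) :=
          mul_le_mul_of_nonneg_left (hsum F) (by positivity)
      _ = M / 4 := by field_simp
  have := hmass k
  linarith

end Construction

/-! ### Hyperbolic pairs of eigenvalues -/

section Arithmetic

/-- The real numbers `a₁`, `a₂` are the two eigenvalues of `A`, and `0 < |a₁| < 1 < |a₂|`. -/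
structure IsHyperbolicPair (A : Matrix (Fin 2) (Fin 2) ℤ) (a₁ a₂ : ℝ) : Prop where
  add : a₁ + a₂ = A 0 0 + A 1 1
  mul : a₁ * a₂ = A 0 0 * A 1 1 - A 0 1 * A 1 0
  pos : 0 < |a₁|
  lt_one : |a₁| < 1
  one_lt : 1 < |a₂|

/-- The left eigenvector `(A 1 0, a - A 0 0)` of `A` for the eigenvalue `a`, as a linear form. -/
def eigenform (A : Matrix (Fin 2) (Fin 2) ℤ) (a : ℝ) (x : Fin 2 → ℝ) : ℝ :=
  A 1 0 * x 0 + (a - A 0 0) * x 1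

/-- The action of an integer matrix on `ℝ²`. -/
def realMulVec (A : Matrix (Fin 2) (Fin 2) ℤ) (x : Fin 2 → ℝ) : Fin 2 → ℝ :=
  fun i => ∑ j, (A i j : ℝ) * x j

theorem eigenform_sub (A : Matrix (Fin 2) (Fin 2) ℤ) (a : ℝ) (x y : Fin 2 → ℝ) :
    eigenform A a (x - y) = eigenform A a x - eigenform A a y := by
  simp only [eigenform, Pi.sub_apply]; ring

theorem eigenform_realMulVec {A : Matrix (Fin 2) (Fin 2) ℤ} {a : ℝ}
    (h : a ^ 2 = (A 0 0 + A 1 1) * a - (A 0 0 * A 1 1 - A 0 1 * A 1 0)) (x : Fin 2 → ℝ) :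
    eigenform A a (realMulVec A x) = a * eigenform A a x := by
  simp only [eigenform, realMulVec, Fin.sum_univ_two]
  linear_combination (-x 1) * h

/-- A rational root of a monic integer quadratic polynomial is an integer. -/
theorem exists_int_of_rat_quadratic {q : ℚ} {t d : ℤ} (h : (q : ℝ) ^ 2 = t * q - d) :
    ∃ z : ℤ, (q : ℝ) = z := by
  have hq : q ^ 2 = t * q - d := by exact_mod_cast h
  have hint : IsIntegral ℤ q := by
    refine ⟨Polynomial.X ^ 2 - Polynomial.C t * Polynomial.X + Polynomial.C d, by monicity!, ?_⟩
    simp only [Polynomial.eval₂_add, Polynomial.eval₂_sub, Polynomial.eval₂_mul,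
      Polynomial.eval₂_pow, Polynomial.eval₂_X, Polynomial.eval₂_C, hq]
    simp
  obtain ⟨z, hz⟩ := IsIntegrallyClosed.isIntegral_iff.1 hint
  exact ⟨z, by rw [← hz]; simp⟩

namespace IsHyperbolicPair

variable {A : Matrix (Fin 2) (Fin 2) ℤ} {a₁ a₂ : ℝ} (h : IsHyperbolicPair A a₁ a₂)
include h

theorem sq_left : a₁ ^ 2 = (A 0 0 + A 1 1) * a₁ - (A 0 0 * A 1 1 - A 0 1 * A 1 0) := by
  rw [← h.add, ← h.mul]; ring

theorem sq_right : a₂ ^ 2 = (A 0 0 + A 1 1) * a₂ - (A 0 0 * A 1 1 - A 0 1 * A 1 0) := by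
  rw [← h.add, ← h.mul]; ring

theorem left_ne_int (z : ℤ) : a₁ ≠ z := by
  intro hz
  have h1 := h.pos
  have h2 := h.lt_one
  rw [hz, ← Int.cast_abs] at h1 h2
  norm_cast at h1 h2
  omega

theorem right_ne_int (z : ℤ) : a₂ ≠ z := by
  intro hz
  refine h.left_ne_int (A 0 0 + A 1 1 - z) ?_
  push_cast
  linarith [h.add]

theorem left_ne_rat (q : ℚ) : a₁ ≠ q := by
  intro hq
  have h1 := h.sq_left
  rw [hq] at h1
  obtain ⟨z, hz⟩ := exists_int_of_rat_quadratic (t := A 0 0 + A 1 1)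
    (d := A 0 0 * A 1 1 - A 0 1 * A 1 0) (by push_cast; exact h1)
  exact h.left_ne_int z (hq.trans hz)

theorem right_ne_rat (q : ℚ) : a₂ ≠ q := by
  intro hq
  have h1 := h.sq_right
  rw [hq] at h1
  obtain ⟨z, hz⟩ := exists_int_of_rat_quadratic (t := A 0 0 + A 1 1)
    (d := A 0 0 * A 1 1 - A 0 1 * A 1 0) (by push_cast; exact h1)
  exact h.right_ne_int z (hq.trans hz)

theorem left_ne_right : a₁ ≠ a₂ := by
  rintro rfl
  linarith [h.lt_one, h.one_lt]

theorem entry_ne_zero : A 1 0 ≠ 0 := by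
  intro hc
  have h1 := h.sq_left
  rw [hc] at h1
  have h2 : (a₁ - A 0 0) * (a₁ - A 1 1) = 0 := by push_cast at h1; linear_combination h1
  rcases mul_eq_zero.1 h2 with h3 | h3
  · exact h.left_ne_int (A 0 0) (by linarith)
  · exact h.left_ne_int (A 1 1) (by linarith)

theorem transpose : IsHyperbolicPair A.transpose a₁ a₂ := by
  refine ⟨?_, ?_, h.pos, h.lt_one, h.one_lt⟩
  · simpa using h.add
  · simpa [mul_comm (A 1 0 : ℝ)] using h.mul

theorem eigenform_ne_zero {a : ℝ} (ha : ∀ q : ℚ, a ≠ q) {k : Fin 2 → ℤ} (hk : k ≠ 0) :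
    eigenform A a (fun i => k i) ≠ 0 := by
  intro h0
  have hc : (A 1 0 : ℝ) ≠ 0 := by exact_mod_cast h.entry_ne_zero
  simp only [eigenform] at h0
  by_cases h1 : k 1 = 0
  · refine hk (funext fun i => ?_)
    rw [h1] at h0
    have : k 0 = 0 := by simpa [h.entry_ne_zero] using h0
    fin_cases i
    · exact this
    · exact h1
  · have h1' : (k 1 : ℝ) ≠ 0 := by exact_mod_cast h1
    refine ha (A 0 0 - A 1 0 * k 0 / k 1) ?_
    push_cast
    field_simp
    linarith

/-- The product of the two eigenforms is `A 1 0` times the integral quadratic form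
`k ↦ det (k, A k)`. -/
theorem eigenform_mul (x : Fin 2 → ℝ) : eigenform A a₁ x * eigenform A a₂ x =
    A 1 0 * (A 1 0 * x 0 ^ 2 + (A 1 1 - A 0 0) * x 0 * x 1 - A 0 1 * x 1 ^ 2) := by
  simp only [eigenform]
  have h1 := h.add
  have h2 := h.mul
  linear_combination (A 1 0 * x 0 * x 1 - A 0 0 * x 1 ^ 2) * h1 + x 1 ^ 2 * h2

/-- The eigendirections are badly approximable: by `eigenform_mul` the product is an integer, and it
is nonzero because the eigenvalues are irrational. -/
theorem one_le_abs_eigenform_mul {k : Fin 2 → ℤ} (hk : k ≠ 0) :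
    1 ≤ |eigenform A a₁ (fun i => k i) * eigenform A a₂ (fun i => k i)| := by
  have hne : eigenform A a₁ (fun i => k i) * eigenform A a₂ (fun i => k i) ≠ 0 :=
    mul_ne_zero (h.eigenform_ne_zero h.left_ne_rat hk) (h.eigenform_ne_zero h.right_ne_rat hk)
  rw [h.eigenform_mul] at hne ⊢
  norm_cast at hne ⊢
  exact Int.one_le_abs hne

end IsHyperbolicPair

/-- Points of a rectangle any two of which differ by `(u, v)` with `|u v| ≥ 1`: their number is at
most the area of the rectangle, up to the additive constant `2`. -/
theorem card_le_of_one_le_abs_mul {ι : Type*} {p q : ι → ℝ}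
    (hpq : ∀ i j, i ≠ j → 1 ≤ |(p i - p j) * (q i - q j)|) {S : Set ι} {u v α β : ℝ}
    (hα : 0 < α) (hβ : 0 ≤ β) (hp : ∀ i ∈ S, |p i - u| ≤ α) (hq : ∀ i ∈ S, |q i - v| ≤ β) :
    ∃ F : Finset ι, (∀ i, i ∈ F ↔ i ∈ S) ∧ (F.card : ℝ) ≤ 4 * α * β + 2 := by
  set M : ℕ := ⌊4 * α * β⌋₊ + 1 with hM
  have hM1 : 4 * α * β < M := by rw [hM]; push_cast; exact Nat.lt_floor_add_one _
  have hM2 : (M : ℝ) ≤ 4 * α * β + 1 := by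
    rw [hM]; push_cast; gcongr; exact Nat.floor_le (by positivity)
  have hM0 : (0 : ℝ) < M := by rw [hM]; positivity
  let f : ι → ℕ := fun i => ⌊(p i - u + α) * M / (2 * α)⌋₊
  have hnn : ∀ i ∈ S, 0 ≤ (p i - u + α) * M / (2 * α) := by
    intro i hi
    have := (abs_le.1 (hp i hi)).1
    have : 0 ≤ p i - u + α := by linarith
    positivity
  have hinj : InjOn f S := by
    intro i hi j hj hij
    by_contra hne
    have h1 := hpq i j hne
    have e1 := Nat.floor_le (hnn i hi)
    have e2 := Nat.lt_floor_add_one ((p i - u + α) * M / (2 * α))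
    have e3 := Nat.floor_le (hnn j hj)
    have e4 := Nat.lt_floor_add_one ((p j - u + α) * M / (2 * α))
    rw [show ⌊(p i - u + α) * M / (2 * α)⌋₊ = ⌊(p j - u + α) * M / (2 * α)⌋₊ from hij] at e1 e2
    have e5 : |(p i - u + α) * M / (2 * α) - (p j - u + α) * M / (2 * α)| < 1 := by
      rw [abs_lt]; constructor <;> linarith
    have e6 : |p i - p j| * M < 2 * α := by
      have : (p i - u + α) * M / (2 * α) - (p j - u + α) * M / (2 * α)
          = (p i - p j) * (M / (2 * α)) := by ring
      rw [this, abs_mul, abs_of_pos (by positivity : (M : ℝ) / (2 * α) > 0), ← mul_div_assoc,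
        div_lt_one (by positivity)] at e5
      exact e5
    have e7 : |q i - q j| ≤ 2 * β := by
      have h2 := abs_le.1 (hq i hi)
      have h3 := abs_le.1 (hq j hj)
      rw [abs_le]; constructor <;> linarith
    rw [abs_mul] at h1
    have e8 : |p i - p j| * |q i - q j| ≤ |p i - p j| * (2 * β) :=
      mul_le_mul_of_nonneg_left e7 (abs_nonneg _)
    have e9 : (|p i - p j| * M) * (2 * β) ≤ 2 * α * (2 * β) :=
      mul_le_mul_of_nonneg_right e6.le (by linarith)
    have e10 : (M : ℝ) * 1 ≤ M * (|p i - p j| * (2 * β)) :=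
      mul_le_mul_of_nonneg_left (h1.trans e8) hM0.le
    linarith
  have hmaps : MapsTo f S (Finset.range (M + 1)) := by
    intro i hi
    simp only [Finset.coe_range, mem_Iio, Nat.lt_succ_iff]
    refine Nat.floor_le_of_le ?_
    rw [div_le_iff₀ (by positivity)]
    have := (abs_le.1 (hp i hi)).2
    nlinarith
  have hfin : S.Finite := Finite.of_injOn hmaps hinj (Finset.finite_toSet _)
  refine ⟨hfin.toFinset, fun i => hfin.mem_toFinset, ?_⟩
  have hcard : hfin.toFinset.card ≤ (Finset.range (M + 1)).card :=
    Finset.card_le_card_of_injOn f (by simpa using hmaps) (by simpa using hinj)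
  rw [Finset.card_range] at hcard
  have : (hfin.toFinset.card : ℝ) ≤ M + 1 := by exact_mod_cast hcard
  linarith

end Arithmetic

/-! ### Eigencoordinates in the plane -/

section Geometry

variable {A : Matrix (Fin 2) (Fin 2) ℤ} {a₁ a₂ : ℝ}

theorem continuous_eigenform (a : ℝ) : Continuous (eigenform A a) := by
  unfold eigenform; fun_prop

/-- The area of a box in eigencoordinates. -/
theorem IsHyperbolicPair.volume_box (h : IsHyperbolicPair A a₁ a₂) (u₁ u₂ : ℝ) {t₁ t₂ : ℝ}
    (ht₁ : 0 ≤ t₁) :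
    volume {y : Fin 2 → ℝ | |eigenform A a₁ y - u₁| ≤ t₁ ∧ |eigenform A a₂ y - u₂| ≤ t₂} =
      ENNReal.ofReal (4 * t₁ * t₂ / |A 1 0 * (a₂ - a₁)|) := by
  set P : Matrix (Fin 2) (Fin 2) ℝ := !![(A 1 0 : ℝ), a₁ - A 0 0; (A 1 0 : ℝ), a₂ - A 0 0] with hP
  have hdet : P.det = A 1 0 * (a₂ - a₁) := by rw [hP, Matrix.det_fin_two_of]; ring
  have hne : P.det ≠ 0 := by
    rw [hdet]
    exact mul_ne_zero (by exact_mod_cast h.entry_ne_zero) (sub_ne_zero.2 h.left_ne_right.symm)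
  have hset : {y : Fin 2 → ℝ | |eigenform A a₁ y - u₁| ≤ t₁ ∧ |eigenform A a₂ y - u₂| ≤ t₂} =
      Matrix.toLin' P ⁻¹' (Set.pi univ fun i =>
        Icc (![u₁ - t₁, u₂ - t₂] i) (![u₁ + t₁, u₂ + t₂] i)) := by
    ext y
    have e : ∀ a : ℝ, eigenform A a y = ∑ j, ![(A 1 0 : ℝ), a - A 0 0] j * y j := by
      intro a; simp [eigenform, Fin.sum_univ_two]
    rw [mem_preimage, Set.mem_pi]
    simp only [mem_ofPred_eq, mem_univ, forall_true_left, Fin.forall_fin_two, abs_le]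
    change _ ↔ (_ ≤ ∑ j, ![(A 1 0 : ℝ), a₁ - A 0 0] j * y j ∧
        ∑ j, ![(A 1 0 : ℝ), a₁ - A 0 0] j * y j ≤ _) ∧
      (_ ≤ ∑ j, ![(A 1 0 : ℝ), a₂ - A 0 0] j * y j ∧
        ∑ j, ![(A 1 0 : ℝ), a₂ - A 0 0] j * y j ≤ _)
    rw [← e, ← e]
    simp only [Matrix.cons_val_zero, Matrix.cons_val_one]
    constructor
    · rintro ⟨⟨_, _⟩, _, _⟩; refine ⟨⟨?_, ?_⟩, ?_, ?_⟩ <;> linarith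
    · rintro ⟨⟨_, _⟩, _, _⟩; refine ⟨⟨?_, ?_⟩, ?_, ?_⟩ <;> linarith
  rw [hset, Measure.addHaar_preimage_linearMap _ (by simpa using hne), LinearMap.det_toLin', hdet,
    volume_pi_pi, Fin.prod_univ_two, Real.volume_Icc, Real.volume_Icc,
    ← ENNReal.ofReal_mul (by simp; linarith), ← ENNReal.ofReal_mul (abs_nonneg _), abs_inv]
  congr 1
  simp only [Matrix.cons_val_zero, Matrix.cons_val_one]
  ring

/-- The two eigenforms are coordinates of the plane: they are bounded by the norm and bound it. -/
theorem IsHyperbolicPair.exists_bound (h : IsHyperbolicPair A a₁ a₂) : ∃ L : ℝ, 0 < L ∧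
    (∀ x, |eigenform A a₁ x| ≤ L * ‖x‖) ∧ (∀ x, |eigenform A a₂ x| ≤ L * ‖x‖) ∧
    ∀ x t, |eigenform A a₁ x| ≤ t → |eigenform A a₂ x| ≤ t → ‖x‖ ≤ L * t := by
  have hc : 0 < |(A 1 0 : ℝ)| := abs_pos.2 (by exact_mod_cast h.entry_ne_zero)
  have hd : 0 < |a₂ - a₁| := abs_pos.2 (sub_ne_zero.2 h.left_ne_right.symm)
  have hle : ∀ a x, |eigenform A a x| ≤ (|(A 1 0 : ℝ)| + |a - A 0 0|) * ‖x‖ := by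
    intro a x
    have h0 := norm_le_pi_norm x 0
    have h1 := norm_le_pi_norm x 1
    rw [Real.norm_eq_abs] at h0 h1
    calc |eigenform A a x| ≤ |(A 1 0 : ℝ)| * |x 0| + |a - A 0 0| * |x 1| := by
          rw [← abs_mul, ← abs_mul]; exact abs_add_le _ _
      _ ≤ |(A 1 0 : ℝ)| * ‖x‖ + |a - A 0 0| * ‖x‖ := by gcongr
      _ = _ := by ring
  set L₁ := |(A 1 0 : ℝ)| + |a₁ - A 0 0|
  set L₂ := |(A 1 0 : ℝ)| + |a₂ - A 0 0|
  set L₃ := 2 / |a₂ - a₁|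
  set L₄ := (1 + |a₁ - A 0 0| * L₃) / |(A 1 0 : ℝ)|
  have hL₁ : 0 < L₁ := by positivity
  have hL₂ : 0 < L₂ := by positivity
  have hL₃ : 0 < L₃ := by positivity
  have hL₄ : 0 < L₄ := by positivity
  refine ⟨L₁ + L₂ + L₃ + L₄, by positivity, fun x => (hle a₁ x).trans ?_,
    fun x => (hle a₂ x).trans ?_, fun x t ht₁ ht₂ => ?_⟩
  · exact mul_le_mul_of_nonneg_right (by linarith) (norm_nonneg x)
  · exact mul_le_mul_of_nonneg_right (by linarith) (norm_nonneg x)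
  · have ht : 0 ≤ t := (abs_nonneg _).trans ht₁
    have hx1 : |x 1| ≤ L₃ * t := by
      have e : (a₂ - a₁) * x 1 = eigenform A a₂ x - eigenform A a₁ x := by
        simp only [eigenform]; ring
      have : |a₂ - a₁| * |x 1| ≤ 2 * t := by
        rw [← abs_mul, e]
        exact (abs_sub _ _).trans (by linarith)
      rw [show L₃ * t = 2 * t / |a₂ - a₁| by simp only [L₃]; ring, le_div_iff₀ hd]
      linarith
    have hx0 : |x 0| ≤ L₄ * t := by
      have e : A 1 0 * x 0 = eigenform A a₁ x - (a₁ - A 0 0) * x 1 := by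
        simp only [eigenform]; ring
      have : |(A 1 0 : ℝ)| * |x 0| ≤ (1 + |a₁ - A 0 0| * L₃) * t := by
        rw [← abs_mul, e]
        refine (abs_sub _ _).trans ?_
        rw [abs_mul]
        have := mul_le_mul_of_nonneg_left hx1 (abs_nonneg (a₁ - A 0 0))
        linarith
      rw [show L₄ * t = (1 + |a₁ - A 0 0| * L₃) * t / |(A 1 0 : ℝ)| by simp only [L₄]; ring,
        le_div_iff₀ hc]
      linarith
    have e3 : L₃ * t ≤ (L₁ + L₂ + L₃ + L₄) * t := mul_le_mul_of_nonneg_right (by linarith) ht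
    have e4 : L₄ * t ≤ (L₁ + L₂ + L₃ + L₄) * t := mul_le_mul_of_nonneg_right (by linarith) ht
    refine (pi_norm_le_iff_of_nonneg (by positivity)).2 fun i => ?_
    rw [Real.norm_eq_abs]
    fin_cases i
    · exact hx0.trans e4
    · exact hx1.trans e3

end Geometry

/-! ### The area of the preimages of balls -/

section Area

/-- The quotient map from the plane to the torus, for the supremum norms. -/
def torusMk (x : Fin 2 → ℝ) : Fin 2 → UnitAddCircle := fun i => (x i : UnitAddCircle)

theorem continuous_torusMk : Continuous torusMk :=
  continuous_pi fun i => (AddCircle.continuous_mk' 1).comp (continuous_apply i)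

theorem torusMk_surjective : Function.Surjective torusMk := fun z =>
  ⟨fun i => (QuotientAddGroup.mk_surjective (z i)).choose,
    funext fun i => (QuotientAddGroup.mk_surjective (z i)).choose_spec⟩

theorem exists_int_norm_le_of_dist_torusMk_le {x w : Fin 2 → ℝ} {ρ : ℝ}
    (h : dist (torusMk x) (torusMk w) ≤ ρ) :
    ∃ k : Fin 2 → ℤ, ‖x - w - fun i => (k i : ℝ)‖ ≤ ρ := by
  have hρ : 0 ≤ ρ := dist_nonneg.trans h
  refine ⟨fun i => round (x i - w i), (pi_norm_le_iff_of_nonneg hρ).2 fun i => ?_⟩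
  have h1 := (dist_pi_le_iff hρ).1 h i
  rw [dist_eq_norm, torusMk, torusMk, ← AddCircle.coe_sub, UnitAddCircle.norm_eq] at h1
  exact h1

theorem dist_torusMk_le (x y : Fin 2 → ℝ) : dist (torusMk x) (torusMk y) ≤ ‖x - y‖ := by
  refine (dist_pi_le_iff (norm_nonneg _)).2 fun i => ?_
  rw [dist_eq_norm, torusMk, torusMk, ← AddCircle.coe_sub]
  refine le_trans ?_ (norm_le_pi_norm (x - y) i)
  rw [UnitAddCircle.norm_eq, Pi.sub_apply, Real.norm_eq_abs]
  simpa using round_le (x i - y i) 0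

variable {A : Matrix (Fin 2) (Fin 2) ℤ} {a₁ a₂ : ℝ}

theorem continuous_realMulVec : Continuous (realMulVec A) := by
  unfold realMulVec; fun_prop

theorem realMulVec_sub (x y : Fin 2 → ℝ) :
    realMulVec A (x - y) = realMulVec A x - realMulVec A y := by
  funext i; simp [realMulVec, mul_sub, Finset.sum_sub_distrib]

theorem realMulVec_iterate_sub (n : ℕ) (x y : Fin 2 → ℝ) :
    (realMulVec A)^[n] (x - y) = (realMulVec A)^[n] x - (realMulVec A)^[n] y := by
  induction n generalizing x y with
  | zero => rfl
  | succ n ih => simp only [Function.iterate_succ, Function.comp_apply, realMulVec_sub, ih]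

theorem eigenform_iterate {a : ℝ}
    (h : a ^ 2 = (A 0 0 + A 1 1) * a - (A 0 0 * A 1 1 - A 0 1 * A 1 0)) (n : ℕ) (x : Fin 2 → ℝ) :
    eigenform A a ((realMulVec A)^[n] x) = a ^ n * eigenform A a x := by
  induction n generalizing x with
  | zero => simp
  | succ n ih =>
    rw [Function.iterate_succ, Function.comp_apply, ih, eigenform_realMulVec h, pow_succ]; ring

/-- The set of the points of the plane whose image under `A ^ n` lies, modulo `ℤ²`, within distance
`ρ` of `z`. -/
def targetPreimage (A : Matrix (Fin 2) (Fin 2) ℤ) (n : ℕ) (z : Fin 2 → UnitAddCircle) (ρ : ℝ) :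
    Set (Fin 2 → ℝ) :=
  {y | dist (torusMk ((realMulVec A)^[n] y)) z ≤ ρ}

theorem isClosed_targetPreimage (n : ℕ) (z : Fin 2 → UnitAddCircle) (ρ : ℝ) :
    IsClosed (targetPreimage A n z ρ) :=
  isClosed_le ((continuous_torusMk.comp (continuous_realMulVec.iterate n)).dist continuous_const)
    continuous_const

/-- A point whose image under an expansion by `b` is within `t` of `v`, and which is within `r` of
`x`, lies in an interval of half-length `min r (t / |b|)`. -/
theorem exists_abs_sub_le_min {b : ℝ} (hb : b ≠ 0) (x v r t : ℝ) :
    ∃ u, ∀ y, |y - x| ≤ r → |b * y - v| ≤ t → |y - u| ≤ min r (t / |b|) := by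
  rcases le_total r (t / |b|) with h | h
  · exact ⟨x, fun y hy _ => by rwa [min_eq_left h]⟩
  · refine ⟨v / b, fun y _ hy => ?_⟩
    rw [min_eq_right h, le_div_iff₀ (abs_pos.2 hb), ← abs_mul,
      show (y - v / b) * b = b * y - v by field_simp]
    exact hy

/-- An upper bound for `(ρ + b * r) * min r (ρ / b)`. -/
theorem add_mul_mul_min_le {b r ρ : ℝ} (hb : 0 < b) (hr : 0 ≤ r) (hρ : 0 ≤ ρ) :
    (ρ + b * r) * min r (ρ / b) ≤ 2 * (ρ * r) := by
  rcases le_total r (ρ / b) with h | h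
  · rw [min_eq_left h]
    have : b * r ≤ ρ := by rw [mul_comm]; exact (le_div_iff₀ hb).1 h
    nlinarith
  · rw [min_eq_right h]
    have h1 : ρ ≤ b * r := by rw [mul_comm]; exact (div_le_iff₀ hb).1 h
    have h2 : 0 ≤ ρ / b := by positivity
    calc (ρ + b * r) * (ρ / b) ≤ (2 * (b * r)) * (ρ / b) := by gcongr; linarith
      _ = 2 * (ρ * r) := by field_simp

/-- The area of `targetPreimage` in a ball. The set is a union of parallelograms, one for each
element of a translated lattice; each contributes the second term of the bound, and their number
is controlled by `card_le_of_one_le_abs_mul`. -/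
theorem IsHyperbolicPair.exists_volume_inter_le (h : IsHyperbolicPair A a₁ a₂) :
    ∃ C : ℝ, 0 < C ∧ ∀ (n : ℕ) (z : Fin 2 → UnitAddCircle) (ρ : ℝ) (x : Fin 2 → ℝ) (r : ℝ),
      0 < ρ → 0 < r → volume (Metric.closedBall x r ∩ targetPreimage A n z ρ) ≤
        ENNReal.ofReal (C * ((ρ * r) ^ 2 +
          min r (ρ / |a₁ ^ n|) * min r (ρ / |a₂ ^ n|))) := by
  obtain ⟨L, hL, hL₁, hL₂, -⟩ := h.exists_bound
  set D := |A 1 0 * (a₂ - a₁)| with hD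
  have hD0 : 0 < D := abs_pos.2 (mul_ne_zero (by exact_mod_cast h.entry_ne_zero)
    (sub_ne_zero.2 h.left_ne_right.symm))
  refine ⟨(16 * L ^ 2 + 2) * (4 * L ^ 2 / D), by positivity, fun n z ρ x r hρ hr => ?_⟩
  obtain ⟨w, rfl⟩ := torusMk_surjective z
  have hb₁ : a₁ ^ n ≠ 0 := pow_ne_zero _ (abs_pos.1 h.pos)
  have hb₂ : a₂ ^ n ≠ 0 := pow_ne_zero _ (abs_pos.1 (one_pos.trans h.one_lt))
  have hb₁' := abs_pos.2 hb₁
  have hb₂' := abs_pos.2 hb₂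
  set m₁ := min r (ρ / |a₁ ^ n|) with hm₁
  set m₂ := min r (ρ / |a₂ ^ n|) with hm₂
  have hm₁0 : 0 < m₁ := lt_min hr (by positivity)
  have hm₂0 : 0 < m₂ := lt_min hr (by positivity)
  let B := (realMulVec A)^[n]
  let c : (Fin 2 → ℤ) → Fin 2 → ℝ := fun k i => k i
  -- the lattice points that contribute
  let S : Set (Fin 2 → ℤ) := {k | ∃ y ∈ Metric.closedBall x r, ‖B y - w - c k‖ ≤ ρ}
  have hS : ∀ a : ℝ, (∀ x, |eigenform A a x| ≤ L * ‖x‖) →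
      (a ^ 2 = (A 0 0 + A 1 1) * a - (A 0 0 * A 1 1 - A 0 1 * A 1 0)) →
      ∀ k ∈ S, |eigenform A a (c k) - (a ^ n * eigenform A a x - eigenform A a w)| ≤
        L * (ρ + |a ^ n| * r) := by
    rintro a ha1 ha2 k ⟨y, hy, hk⟩
    have e : eigenform A a (c k) - (a ^ n * eigenform A a x - eigenform A a w) =
        a ^ n * eigenform A a (y - x) - eigenform A a (B y - w - c k) := by
      simp only [eigenform_sub, B, eigenform_iterate ha2]; ring
    rw [e]
    refine (abs_sub _ _).trans ?_
    rw [abs_mul]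
    have h1 : |a ^ n| * |eigenform A a (y - x)| ≤ |a ^ n| * (L * r) := by
      refine mul_le_mul_of_nonneg_left ((ha1 _).trans ?_) (abs_nonneg _)
      exact mul_le_mul_of_nonneg_left (by simpa [dist_eq_norm] using hy) hL.le
    have h2 := (ha1 (B y - w - c k)).trans (mul_le_mul_of_nonneg_left hk hL.le)
    linarith
  obtain ⟨F, hF, hcard⟩ := card_le_of_one_le_abs_mul
    (p := fun k => eigenform A a₁ (c k)) (q := fun k => eigenform A a₂ (c k)) (S := S)
    (fun i j hij => by
      have := h.one_le_abs_eigenform_mul (k := i - j) (sub_ne_zero.2 hij)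
      rw [← eigenform_sub, ← eigenform_sub]
      convert this using 5 <;> simp [c])
    (show 0 < L * (ρ + |a₁ ^ n| * r) by positivity) (show 0 ≤ L * (ρ + |a₂ ^ n| * r) by positivity)
    (hS a₁ hL₁ h.sq_left) (hS a₂ hL₂ h.sq_right)
  have hbox : ∀ k, ∃ u : ℝ × ℝ, ∀ y ∈ Metric.closedBall x r, ‖B y - w - c k‖ ≤ ρ →
      |eigenform A a₁ y - u.1| ≤ L * m₁ ∧ |eigenform A a₂ y - u.2| ≤ L * m₂ := by
    intro k
    have key : ∀ a : ℝ, (∀ x, |eigenform A a x| ≤ L * ‖x‖) →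
        (a ^ 2 = (A 0 0 + A 1 1) * a - (A 0 0 * A 1 1 - A 0 1 * A 1 0)) → a ^ n ≠ 0 →
        ∃ u, ∀ y ∈ Metric.closedBall x r, ‖B y - w - c k‖ ≤ ρ →
          |eigenform A a y - u| ≤ L * min r (ρ / |a ^ n|) := by
      intro a ha1 ha2 ha3
      obtain ⟨u, hu⟩ := exists_abs_sub_le_min ha3 (eigenform A a x) (eigenform A a (w + c k))
        (L * r) (L * ρ)
      refine ⟨u, fun y hy hk => ?_⟩
      rw [mul_min_of_nonneg _ _ hL.le, ← mul_div_assoc]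
      refine hu _ ?_ ?_
      · rw [← eigenform_sub]
        refine (ha1 _).trans (mul_le_mul_of_nonneg_left (by simpa [dist_eq_norm] using hy) hL.le)
      · rw [← eigenform_iterate ha2, ← eigenform_sub, ← sub_sub]
        exact (ha1 _).trans (mul_le_mul_of_nonneg_left hk hL.le)
    obtain ⟨u₁, hu₁⟩ := key a₁ hL₁ h.sq_left hb₁
    obtain ⟨u₂, hu₂⟩ := key a₂ hL₂ h.sq_right hb₂
    exact ⟨(u₁, u₂), fun y hy hk => ⟨hu₁ y hy hk, hu₂ y hy hk⟩⟩
  choose u hu using hbox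
  have hsub : Metric.closedBall x r ∩ targetPreimage A n (torusMk w) ρ ⊆ ⋃ k ∈ F,
      {y | |eigenform A a₁ y - (u k).1| ≤ L * m₁ ∧ |eigenform A a₂ y - (u k).2| ≤ L * m₂} := by
    rintro y ⟨hy, hyz⟩
    obtain ⟨k, hk⟩ := exists_int_norm_le_of_dist_torusMk_le hyz
    exact mem_iUnion₂.2 ⟨k, (hF k).2 ⟨y, hy, hk⟩, hu k y hy hk⟩
  refine (measure_mono hsub).trans ((measure_biUnion_finset_le _ _).trans ?_)
  simp_rw [h.volume_box _ _ (show 0 ≤ L * m₁ by positivity)]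
  rw [Finset.sum_const, nsmul_eq_mul, ← ENNReal.ofReal_natCast,
    ← ENNReal.ofReal_mul (Nat.cast_nonneg _)]
  refine ENNReal.ofReal_le_ofReal ?_
  have h₁ := add_mul_mul_min_le hb₁' hr.le hρ.le
  have h₂ := add_mul_mul_min_le hb₂' hr.le hρ.le
  rw [← hm₁] at h₁
  rw [← hm₂] at h₂
  have h₁₂ := mul_le_mul h₁ h₂ (by positivity) (by positivity)
  calc (F.card : ℝ) * (4 * (L * m₁) * (L * m₂) / |A 1 0 * (a₂ - a₁)|)
      ≤ (4 * (L * (ρ + |a₁ ^ n| * r)) * (L * (ρ + |a₂ ^ n| * r)) + 2) *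
          (4 * (L * m₁) * (L * m₂) / D) := by gcongr
    _ = (4 * L ^ 2 * (((ρ + |a₁ ^ n| * r) * m₁) * ((ρ + |a₂ ^ n| * r) * m₂)) + 2 * (m₁ * m₂)) *
          (4 * L ^ 2 / D) := by ring
    _ ≤ ((16 * L ^ 2 + 2) * ((ρ * r) ^ 2 + m₁ * m₂)) * (4 * L ^ 2 / D) := by
        refine mul_le_mul_of_nonneg_right ?_ (by positivity)
        have h3 : 0 ≤ (ρ * r) ^ 2 := by positivity
        have h4 : 0 ≤ m₁ * m₂ := by positivity
        have h5 : 0 ≤ L ^ 2 := by positivity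
        have h6 := mul_le_mul_of_nonneg_left h₁₂ (by positivity : 0 ≤ 4 * L ^ 2)
        have h7 : 0 ≤ L ^ 2 * (m₁ * m₂) := by positivity
        nlinarith
    _ = _ := by ring

/-- The dimension of the shrinking target set, as a function of `l₁ = log |λ₁|`, `l₂ = log |λ₂|`
and the rate `τ`. -/
def targetDim (l₁ l₂ τ : ℝ) : ℝ :=
  if τ ≤ l₂ then 2 * l₂ / (τ + l₂) else (l₁ + l₂) / (τ + l₁)

theorem targetDim_nonneg {l₁ l₂ τ : ℝ} (h₁ : l₁ < 0) (h₁₂ : 0 ≤ l₁ + l₂) (hτ : 0 < τ) :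
    0 ≤ targetDim l₁ l₂ τ := by
  unfold targetDim
  split_ifs with h
  · exact div_nonneg (by linarith) (by linarith)
  · exact div_nonneg h₁₂ (by linarith)

theorem targetDim_le_two {l₁ l₂ τ : ℝ} (h₁ : l₁ < 0) (h₁₂ : 0 ≤ l₁ + l₂) (hτ : 0 < τ) :
    targetDim l₁ l₂ τ ≤ 2 := by
  unfold targetDim
  split_ifs with h
  · rw [div_le_iff₀ (by linarith)]; linarith
  · rw [div_le_iff₀ (by linarith)]; linarith

/-- An interpolation between two upper bounds of a minimum. -/
theorem min_le_rpow_mul_rpow {r q θ : ℝ} (hr : 0 < r) (hq : 0 < q) (h0 : 0 ≤ θ) (h1 : θ ≤ 1) :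
    min r q ≤ r ^ θ * q ^ (1 - θ) := by
  have hm : 0 < min r q := lt_min hr hq
  calc min r q = min r q ^ θ * min r q ^ (1 - θ) := by
        rw [← Real.rpow_add hm, add_sub_cancel, Real.rpow_one]
    _ ≤ r ^ θ * q ^ (1 - θ) := by
        refine mul_le_mul (Real.rpow_le_rpow hm.le (min_le_left _ _) h0)
          (Real.rpow_le_rpow hm.le (min_le_right _ _) (by linarith)) (by positivity) (by positivity)

/-- The exponent `targetDim` is such that a parallelogram with sides `κ e^{-n(τ + l₁)}` and
`κ e^{-n(τ + l₂)}` meets a ball of radius `r` in an area `O(e^{-2nτ} r^s)`. -/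
theorem min_mul_min_le {l₁ l₂ τ κ r : ℝ} (h₁ : l₁ < 0) (h₁₂ : 0 ≤ l₁ + l₂) (hτ : 0 < τ)
    (hκ : 0 < κ) (hr : 0 < r) (n : ℕ) :
    min r (κ * Real.exp (-(n * τ)) / Real.exp (n * l₁)) *
      min r (κ * Real.exp (-(n * τ)) / Real.exp (n * l₂)) ≤
    κ ^ (-targetDim l₁ l₂ τ) * (κ * Real.exp (-(n * τ))) ^ 2 * r ^ targetDim l₁ l₂ τ := by
  have e : ∀ l : ℝ, κ * Real.exp (-(n * τ)) / Real.exp (n * l) = κ * Real.exp (-(n * (τ + l))) := by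
    intro l
    rw [mul_div_assoc, ← Real.exp_sub]; congr 2; ring
  have hexp : ∀ x θ : ℝ, (κ * Real.exp x) ^ θ = κ ^ θ * Real.exp (x * θ) := by
    intro x θ
    rw [Real.mul_rpow hκ.le (Real.exp_pos _).le, ← Real.exp_mul]
  have hq : ∀ l : ℝ, 0 < κ * Real.exp (-(n * (τ + l))) := fun l => by positivity
  rw [e, e]
  set s := targetDim l₁ l₂ τ with hs
  have hsq : κ ^ (-s) * (κ * Real.exp (-(n * τ))) ^ 2 = κ ^ (2 - s) * Real.exp (-(2 * n * τ)) := by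
    rw [mul_pow, ← mul_assoc, ← Real.exp_nat_mul, show (κ ^ (-s) * κ ^ 2) = κ ^ (2 - s) by
      rw [sub_eq_add_neg, add_comm, Real.rpow_add hκ]; simp]
    congr 2; push_cast; ring
  rw [hsq]
  have hs0 : 0 ≤ s := targetDim_nonneg h₁ h₁₂ hτ
  by_cases h : τ ≤ l₂
  · have hs' : s = 2 * l₂ / (τ + l₂) := by rw [hs, targetDim, if_pos h]
    have hs1 : 1 ≤ s := by rw [hs', le_div_iff₀ (by linarith)]; linarith
    have hs2 : s ≤ 2 := targetDim_le_two h₁ h₁₂ hτ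
    have hmul : (τ + l₂) * (2 - s) = 2 * τ := by
      rw [hs']; field_simp [show τ + l₂ ≠ 0 by linarith]; ring
    calc _ ≤ r * (r ^ (s - 1) * (κ * Real.exp (-(n * (τ + l₂)))) ^ (1 - (s - 1))) := by
          gcongr
          · exact min_le_left _ _
          · exact min_le_rpow_mul_rpow hr (hq _) (by linarith) (by linarith)
      _ = κ ^ (2 - s) * Real.exp (-(2 * n * τ)) * r ^ s := by
          rw [hexp, show 1 - (s - 1) = 2 - s by ring,
            show -(n * (τ + l₂)) * (2 - s) = -(2 * n * τ) by linear_combination (-(n : ℝ)) * hmul,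
            show r ^ s = r * r ^ (s - 1) by rw [Real.rpow_sub_one hr.ne']; field_simp]
          ring
  · have hs' : s = (l₁ + l₂) / (τ + l₁) := by rw [hs, targetDim, if_neg h]
    have hτl : 0 < τ + l₁ := by linarith
    have hs1 : s ≤ 1 := by rw [hs', div_le_iff₀ hτl]; linarith
    have hmul : (τ + l₁) * s = l₁ + l₂ := by rw [hs']; field_simp
    calc _ ≤ (r ^ s * (κ * Real.exp (-(n * (τ + l₁)))) ^ (1 - s)) *
            (κ * Real.exp (-(n * (τ + l₂)))) := by
          gcongr
          · exact min_le_rpow_mul_rpow hr (hq _) hs0 hs1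
          · exact min_le_right _ _
      _ = κ ^ (2 - s) * Real.exp (-(2 * n * τ)) * r ^ s := by
          have e1 : κ ^ (2 - s) = κ ^ (1 - s) * κ := by
            rw [show (2 - s) = (1 - s) + 1 by ring, Real.rpow_add_one hκ.ne']
          have e2 : Real.exp (-(2 * n * τ)) =
              Real.exp (-(n * (τ + l₁)) * (1 - s)) * Real.exp (-(n * (τ + l₂))) := by
            rw [← Real.exp_add]; congr 1; linear_combination (-(n : ℝ)) * hmul
          rw [hexp, e1, e2]
          ring

theorem IsHyperbolicPair.log_neg (h : IsHyperbolicPair A a₁ a₂) : Real.log |a₁| < 0 :=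
  Real.log_neg h.pos h.lt_one

theorem IsHyperbolicPair.abs_mul_eq (h : IsHyperbolicPair A a₁ a₂) : |a₁ * a₂| = |A.det| := by
  rw [h.mul, Matrix.det_fin_two]; push_cast; rfl

theorem IsHyperbolicPair.det_ne_zero (h : IsHyperbolicPair A a₁ a₂) : A.det ≠ 0 := by
  intro h0
  have h1 := h.abs_mul_eq
  rw [h0, abs_mul] at h1
  have h2 := mul_pos h.pos (one_pos.trans h.one_lt)
  simp at h1
  rcases h1 with h1 | h1 <;> simp [h1] at h2

theorem IsHyperbolicPair.log_add_log (h : IsHyperbolicPair A a₁ a₂) :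
    Real.log |a₁| + Real.log |a₂| = Real.log |(A.det : ℝ)| := by
  rw [← Real.log_mul h.pos.ne' (one_pos.trans h.one_lt).ne', ← abs_mul, h.abs_mul_eq]
  simp

theorem IsHyperbolicPair.log_add_log_nonneg (h : IsHyperbolicPair A a₁ a₂) :
    0 ≤ Real.log |a₁| + Real.log |a₂| := by
  rw [h.log_add_log]
  refine Real.log_nonneg ?_
  exact_mod_cast Int.one_le_abs h.det_ne_zero

/-- The estimate of `exists_volume_inter_le` for targets of radius `κ e^{-nτ}`, in Frostman form. -/
theorem IsHyperbolicPair.exists_volume_inter_le_rpow (h : IsHyperbolicPair A a₁ a₂) {τ κ : ℝ}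
    (hτ : 0 < τ) (hκ : 0 < κ) :
    ∃ C : ℝ, 0 < C ∧ ∀ (n : ℕ) (z : Fin 2 → UnitAddCircle) (x : Fin 2 → ℝ) (r : ℝ), 0 < r →
      volume (Metric.closedBall x r ∩ targetPreimage A n z (κ * Real.exp (-(n * τ)))) ≤
        ENNReal.ofReal (C * Real.exp (-(n * τ)) ^ 2 *
          (r ^ 2 + r ^ targetDim (Real.log |a₁|) (Real.log |a₂|) τ)) := by
  obtain ⟨C, hC, hvol⟩ := h.exists_volume_inter_le
  set s := targetDim (Real.log |a₁|) (Real.log |a₂|) τ with hs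
  have hκs : 0 < κ ^ (-s) := Real.rpow_pos_of_pos hκ _
  refine ⟨C * (1 + κ ^ (-s)) * κ ^ 2, by positivity, fun n z x r hr => ?_⟩
  refine (hvol n z _ x r (by positivity) hr).trans (ENNReal.ofReal_le_ofReal ?_)
  have h1 := min_mul_min_le h.log_neg h.log_add_log_nonneg hτ hκ hr n
  rw [Real.exp_nat_mul, Real.exp_log h.pos, Real.exp_nat_mul,
    Real.exp_log (one_pos.trans h.one_lt), ← abs_pow, ← abs_pow, ← hs] at h1
  have h2 : 0 < r ^ s := Real.rpow_pos_of_pos hr _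
  set X := κ * Real.exp (-(n * τ)) with hX
  calc C * ((X * r) ^ 2 + _) ≤ C * ((X * r) ^ 2 + κ ^ (-s) * X ^ 2 * r ^ s) := by gcongr
    _ ≤ C * ((1 + κ ^ (-s)) * X ^ 2 * (r ^ 2 + r ^ s)) := by
        refine mul_le_mul_of_nonneg_left ?_ hC.le
        have e1 : 0 ≤ X ^ 2 * r ^ s := by positivity
        have e2 : 0 ≤ κ ^ (-s) * X ^ 2 * r ^ 2 := by positivity
        nlinarith
    _ = _ := by rw [hX]; ring

end Area

/-! ### Periodization and Fourier coefficients -/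

section Periodization

instance isProbabilityMeasure_unitAddTorus :
    IsProbabilityMeasure (volume : Measure (Fin 2 → UnitAddCircle)) := by
  have : IsProbabilityMeasure (volume : Measure UnitAddCircle) :=
    ⟨by rw [AddCircle.measure_univ]; simp⟩
  infer_instance

theorem integrable_of_continuous_torus {G : Type*} [NormedAddCommGroup G]
    {f : (Fin 2 → UnitAddCircle) → G} (hf : Continuous f) : Integrable f :=
  hf.integrable_of_hasCompactSupport (HasCompactSupport.of_compactSpace f)

theorem torusMk_add (x y : Fin 2 → ℝ) : torusMk (x + y) = torusMk x + torusMk y :=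
  funext fun i => AddCircle.coe_add 1 (x i) (y i)

theorem torusMk_intCast (k : Fin 2 → ℤ) : torusMk (fun i => (k i : ℝ)) = 0 := by
  funext i
  exact (AddCircle.coe_eq_zero_iff 1).2 ⟨k i, by simp⟩

theorem torusMk_eq_iff {x y : Fin 2 → ℝ} :
    torusMk x = torusMk y ↔ ∃ k : Fin 2 → ℤ, x = y + fun i => (k i : ℝ) := by
  constructor
  · intro h
    obtain ⟨k, hk⟩ := exists_int_norm_le_of_dist_torusMk_le (x := x) (w := y) (ρ := 0)
      (by rw [h, dist_self])
    refine ⟨k, ?_⟩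
    have := norm_le_zero_iff.1 hk
    rw [sub_sub, sub_eq_zero] at this
    exact this
  · rintro ⟨k, rfl⟩
    rw [torusMk_add, torusMk_intCast, add_zero]

theorem isOpenQuotientMap_torusMk : IsOpenQuotientMap torusMk :=
  IsOpenQuotientMap.piMap (f := fun _ : Fin 2 => ((↑) : ℝ → UnitAddCircle))
    fun _ => QuotientAddGroup.isOpenQuotientMap_mk

/-- The unit cell with lower left corner `k`. -/
def unitCell (k : Fin 2 → ℤ) : Set (Fin 2 → ℝ) :=
  Set.pi univ fun i => Ioc (k i : ℝ) (k i + 1)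

theorem measurableSet_unitCell (k : Fin 2 → ℤ) : MeasurableSet (unitCell k) :=
  MeasurableSet.univ_pi fun _ => measurableSet_Ioc

theorem mem_unitCell_iff {k : Fin 2 → ℤ} {x : Fin 2 → ℝ} :
    x ∈ unitCell k ↔ k = fun i => ⌈x i⌉ - 1 := by
  simp only [unitCell, Set.mem_pi, mem_univ, forall_true_left, mem_Ioc, funext_iff]
  refine forall_congr' fun i => ?_
  rw [eq_sub_iff_add_eq, eq_comm, Int.ceil_eq_iff]
  push_cast
  rw [add_sub_cancel_right]

theorem measurePreserving_torusMk (k : Fin 2 → ℤ) :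
    MeasurePreserving torusMk (volume.restrict (unitCell k)) volume := by
  rw [unitCell, volume_pi, Measure.restrict_pi_pi]
  exact measurePreserving_pi _ _ fun i => AddCircle.measurePreserving_mk 1 (k i : ℝ)

theorem setIntegral_unitCell {G : Type*} [NormedAddCommGroup G] [NormedSpace ℝ G]
    {f : (Fin 2 → UnitAddCircle) → G} (hf : Continuous f) (k : Fin 2 → ℤ) :
    ∫ x in unitCell k, f (torusMk x) = ∫ x, f x := by
  have h := measurePreserving_torusMk k
  rw [← h.map_eq, integral_map h.measurable.aemeasurable hf.aestronglyMeasurable]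

/-- The integral of a compactly supported function against a periodic one is an integral over the
torus, against the periodization `x ↦ ∑ₖ φ (x + k)`. -/
theorem exists_periodization {φ : (Fin 2 → ℝ) → ℂ} (hφ : Continuous φ) (hφc : HasCompactSupport φ) :
    ∃ F : C(Fin 2 → UnitAddCircle, ℂ), ∀ g : (Fin 2 → UnitAddCircle) → ℂ, Continuous g →
      ∫ x, φ x * g (torusMk x) = ∫ x, F x * g x := by
  obtain ⟨R, hR⟩ := hφc.isCompact.isBounded.subset_closedBall 0
  have hsupp : ∀ x, φ x ≠ 0 → ‖x‖ ≤ R := fun x hx => by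
    simpa using hR (subset_tsupport φ hx)
  let c : (Fin 2 → ℤ) → Fin 2 → ℝ := fun k i => k i
  -- for bounded `x`, only finitely many translates contribute
  let S : ℝ → Finset (Fin 2 → ℤ) := fun M => Fintype.piFinset fun _ => Finset.Icc (-⌈R + M⌉) ⌈R + M⌉
  have hS : ∀ M x k, ‖x‖ ≤ M → φ (x + c k) ≠ 0 → k ∈ S M := by
    intro M x k hx hk
    have h1 := hsupp _ hk
    have h2 : ‖c k‖ ≤ R + M := by
      calc ‖c k‖ = ‖(x + c k) - x‖ := by rw [add_sub_cancel_left]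
        _ ≤ ‖x + c k‖ + ‖x‖ := norm_sub_le _ _
        _ ≤ R + M := add_le_add h1 hx
    refine Fintype.mem_piFinset.2 fun i => ?_
    have h3 : |(k i : ℝ)| ≤ R + M := (norm_le_pi_norm (c k) i).trans h2
    have h4 := h3.trans (Int.le_ceil _)
    rw [← Int.cast_abs] at h4
    rw [Finset.mem_Icc, ← abs_le]
    exact_mod_cast h4
  let Φ : (Fin 2 → ℝ) → ℂ := fun x => ∑ᶠ k, φ (x + c k)
  have hΦ : Continuous Φ := by
    refine continuous_finsum (fun k => hφ.comp (continuous_id.add continuous_const)) fun x => ?_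
    refine ⟨Metric.ball x 1, Metric.ball_mem_nhds x one_pos,
      (Finset.finite_toSet (S (‖x‖ + 1))).subset ?_⟩
    rintro k ⟨y, hy, hyx⟩
    refine hS _ y k ?_ hy
    have := norm_sub_norm_le y x
    rw [Metric.mem_ball, dist_eq_norm] at hyx
    linarith
  have hfac : Function.FactorsThrough Φ torusMk := by
    intro x y hxy
    obtain ⟨k, rfl⟩ := torusMk_eq_iff.1 hxy
    refine finsum_eq_of_bijective (fun j => j + k) (Equiv.addRight k).bijective fun j => ?_
    rw [add_assoc]
    congr 2
    funext i
    simp [c, add_comm]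
  let F : C(Fin 2 → UnitAddCircle, ℂ) :=
    isOpenQuotientMap_torusMk.isQuotientMap.lift (f := ⟨torusMk, continuous_torusMk⟩) ⟨Φ, hΦ⟩ hfac
  have hF : ∀ x, F (torusMk x) = Φ x := fun x =>
    DFunLike.congr_fun (isOpenQuotientMap_torusMk.isQuotientMap.lift_comp
      (f := ⟨torusMk, continuous_torusMk⟩) ⟨Φ, hΦ⟩ hfac) x
  refine ⟨F, fun g hg => ?_⟩
  have hgt : Continuous fun x => g (torusMk x) := hg.comp continuous_torusMk
  have hint : Integrable fun x => φ x * g (torusMk x) :=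
    (hφ.mul hgt).integrable_of_hasCompactSupport hφc.mul_right
  have hcell : ∀ x ∈ unitCell 0, ‖x‖ ≤ 1 := by
    intro x hx
    refine (pi_norm_le_iff_of_nonneg zero_le_one).2 fun i => ?_
    have := hx i trivial
    simp only [Pi.zero_apply, Int.cast_zero, zero_add] at this
    rw [Real.norm_eq_abs, abs_of_pos this.1]
    exact this.2
  have htrans : ∀ k, ∫ x in unitCell k, φ x * g (torusMk x) =
      ∫ x in unitCell 0, φ (x + c k) * g (torusMk x) := by
    intro k
    have h1 := (measurePreserving_add_right (volume : Measure (Fin 2 → ℝ)) (c k)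
      ).setIntegral_preimage_emb (measurableEmbedding_addRight (c k))
      (fun x => φ x * g (torusMk x)) (unitCell k)
    rw [← h1]
    have h2 : (fun x => x + c k) ⁻¹' unitCell k = unitCell 0 := by
      ext x
      simp only [unitCell, Set.mem_preimage, Set.mem_pi, mem_univ, forall_true_left, mem_Ioc, c,
        Pi.add_apply, Pi.zero_apply, Int.cast_zero, zero_add]
      refine forall_congr' fun i => ⟨fun h => ⟨by linarith, by linarith⟩,
        fun h => ⟨by linarith, by linarith⟩⟩
    rw [h2]
    refine setIntegral_congr_fun (measurableSet_unitCell 0) fun x _ => ?_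
    simp only [c, torusMk_add, torusMk_intCast, add_zero]
  calc ∫ x, φ x * g (torusMk x)
      = ∫ x in ⋃ k ∈ S 1, unitCell k, φ x * g (torusMk x) := by
        refine (setIntegral_eq_integral_of_forall_compl_eq_zero fun x hx => ?_).symm
        by_contra hne
        refine hx ?_
        have hk : x ∈ unitCell fun i => ⌈x i⌉ - 1 := mem_unitCell_iff.2 rfl
        set k : Fin 2 → ℤ := fun i => ⌈x i⌉ - 1
        refine mem_iUnion₂.2 ⟨k, hS 1 (x - c k) k (hcell _ ?_) ?_, hk⟩
        · intro i _
          have := hk i trivial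
          simp only [Pi.sub_apply, c, Pi.zero_apply, Int.cast_zero, zero_add, mem_Ioc]
          exact ⟨by linarith [this.1], by linarith [this.2]⟩
        · rw [sub_add_cancel]
          exact left_ne_zero_of_mul hne
    _ = ∑ k ∈ S 1, ∫ x in unitCell k, φ x * g (torusMk x) := by
        refine integral_biUnion_finset _ (fun k _ => measurableSet_unitCell k) ?_
          fun k _ => hint.integrableOn
        intro k _ l _ hkl
        refine Set.disjoint_left.2 fun x hx hx' => hkl ?_
        rw [mem_unitCell_iff.1 hx, mem_unitCell_iff.1 hx']
    _ = ∑ k ∈ S 1, ∫ x in unitCell 0, φ (x + c k) * g (torusMk x) :=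
        Finset.sum_congr rfl fun k _ => htrans k
    _ = ∫ x in unitCell 0, ∑ k ∈ S 1, φ (x + c k) * g (torusMk x) := by
        refine (integral_finsetSum _ fun k _ => Integrable.integrableOn ?_).symm
        refine ((hφ.comp (continuous_id.add continuous_const)).mul hgt
          ).integrable_of_hasCompactSupport (HasCompactSupport.mul_right ?_)
        exact hφc.comp_homeomorph (Homeomorph.addRight (c k))
    _ = ∫ x in unitCell 0, F (torusMk x) * g (torusMk x) := by
        refine setIntegral_congr_fun (measurableSet_unitCell 0) fun x hx => ?_
        rw [hF, ← Finset.sum_mul]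
        congr 1
        refine (finsum_eq_sum_of_support_subset _ fun k hk => ?_).symm
        exact hS 1 x k (hcell x hx) hk
    _ = ∫ x, F x * g x := setIntegral_unitCell (f := fun x => F x * g x) (F.continuous.mul hg) 0

theorem mFourier_apply_add (m : Fin 2 → ℤ) (x y : Fin 2 → UnitAddCircle) :
    UnitAddTorus.mFourier m (x + y) = UnitAddTorus.mFourier m x * UnitAddTorus.mFourier m y := by
  simp only [UnitAddTorus.mFourier, ContinuousMap.coe_mk, ← Finset.prod_mul_distrib, Pi.add_apply,
    fourier_apply, smul_add, AddCircle.toCircle_add, Circle.coe_mul]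

theorem norm_mFourier_apply (m : Fin 2 → ℤ) (x : Fin 2 → UnitAddCircle) :
    ‖UnitAddTorus.mFourier m x‖ = 1 := by
  simp only [UnitAddTorus.mFourier, ContinuousMap.coe_mk, norm_prod, fourier_apply]
  exact Finset.prod_eq_one fun i _ => Circle.norm_coe _

theorem mFourier_torusMk (m : Fin 2 → ℤ) (x : Fin 2 → ℝ) :
    UnitAddTorus.mFourier m (torusMk x) =
      Complex.exp (2 * Real.pi * Complex.I * ((m 0 * x 0 + m 1 * x 1 : ℝ) : ℂ)) := by
  simp only [UnitAddTorus.mFourier, ContinuousMap.coe_mk, Fin.prod_univ_two, torusMk,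
    fourier_coe_apply, ← Complex.exp_add]
  congr 1
  push_cast
  ring

theorem mFourier_torusMk_eq_one_iff (m : Fin 2 → ℤ) (x : Fin 2 → ℝ) :
    UnitAddTorus.mFourier m (torusMk x) = 1 ↔ ∃ q : ℤ, m 0 * x 0 + m 1 * x 1 = q := by
  rw [mFourier_torusMk, Complex.exp_eq_one_iff]
  refine exists_congr fun q => ?_
  have : (2 * Real.pi * Complex.I : ℂ) ≠ 0 := Complex.two_pi_I_ne_zero
  rw [mul_comm, mul_left_inj' this]
  norm_cast

/-- A Fourier coefficient vanishes if the function has a period on which the character is not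
trivial. -/
theorem integral_mFourier_mul_eq_zero {m : Fin 2 → ℤ} {y : Fin 2 → UnitAddCircle}
    (hy : UnitAddTorus.mFourier m y ≠ 1) {g : (Fin 2 → UnitAddCircle) → ℂ}
    (hg : ∀ x, g (x + y) = g x) : ∫ x, UnitAddTorus.mFourier m x * g x = 0 := by
  have h1 := integral_add_right_eq_self (μ := (volume : Measure (Fin 2 → UnitAddCircle)))
    (fun x => UnitAddTorus.mFourier m x * g x) y
  simp only [mFourier_apply_add, hg, mul_right_comm _ (UnitAddTorus.mFourier m y)] at h1
  rw [integral_mul_const] at h1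
  by_contra hne
  exact hy (mul_left_cancel₀ hne (by rw [h1, mul_one]))

/-- A sequence of probability densities on the torus whose nontrivial Fourier coefficients tend to
zero converges weakly to the Haar measure. -/
theorem tendsto_integral_mul_of_fourier {g : ℕ → (Fin 2 → UnitAddCircle) → ℝ}
    (hg : ∀ n, Continuous (g n)) (hg0 : ∀ n x, 0 ≤ g n x) (hg1 : ∀ n, ∫ x, g n x = 1)
    (hcoef : ∀ m : Fin 2 → ℤ, m ≠ 0 →
      Tendsto (fun n => ∫ x, UnitAddTorus.mFourier m x * (g n x : ℂ)) atTop (𝓝 0))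
    (F : C(Fin 2 → UnitAddCircle, ℂ)) :
    Tendsto (fun n => ∫ x, F x * (g n x : ℂ)) atTop (𝓝 (∫ x, F x)) := by
  have hgc : ∀ n, Continuous fun x => (g n x : ℂ) := fun n => Complex.continuous_ofReal.comp (hg n)
  have hint : ∀ (P : C(Fin 2 → UnitAddCircle, ℂ)) n, Integrable fun x => P x * (g n x : ℂ) :=
    fun P n => integrable_of_continuous_torus (P.continuous.mul (hgc n))
  have hspan : ∀ P ∈ Submodule.span ℂ (Set.range (UnitAddTorus.mFourier (d := Fin 2))),
      Tendsto (fun n => ∫ x, P x * (g n x : ℂ)) atTop (𝓝 (∫ x, P x)) := by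
    intro P hP
    induction hP using Submodule.span_induction with
    | mem P hP =>
      obtain ⟨m, rfl⟩ := hP
      by_cases hm : m = 0
      · subst hm
        have h1 : ∀ n, ∫ x, UnitAddTorus.mFourier (0 : Fin 2 → ℤ) x * (g n x : ℂ) = 1 := by
          intro n
          simp only [UnitAddTorus.mFourier_zero, ContinuousMap.one_apply, one_mul]
          rw [integral_complex_ofReal, hg1]
          simp
        simp only [h1]
        simp [UnitAddTorus.mFourier_zero]
      · obtain ⟨i, hi⟩ := Function.ne_iff.1 hm
        have h0 : ∫ x, UnitAddTorus.mFourier m x = 0 := by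
          have hi' : (m i : ℝ) ≠ 0 := by exact_mod_cast hi
          have hy : UnitAddTorus.mFourier m
              (torusMk (Pi.single i (1 / (2 * (m i : ℝ))))) ≠ 1 := by
            rw [Ne, mFourier_torusMk_eq_one_iff]
            rintro ⟨q, hq⟩
            have h2 : (m 0 : ℝ) * (Pi.single i (1 / (2 * (m i : ℝ))) : Fin 2 → ℝ) 0 +
                m 1 * (Pi.single i (1 / (2 * (m i : ℝ))) : Fin 2 → ℝ) 1 = 1 / 2 := by
              fin_cases i
              · simp at hi' ⊢; field_simp
              · simp at hi' ⊢; field_simp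
            rw [h2] at hq
            have h3 : (1 : ℝ) = 2 * q := by linarith
            norm_cast at h3
            omega
          simpa using integral_mFourier_mul_eq_zero (g := fun _ => 1) hy (fun _ => rfl)
        rw [h0]
        exact hcoef m hm
    | zero => simp
    | add P Q _ _ hP hQ =>
      have h1 : ∀ n, ∫ x, (P + Q) x * (g n x : ℂ) =
          (∫ x, P x * (g n x : ℂ)) + ∫ x, Q x * (g n x : ℂ) := by
        intro n
        rw [← integral_add (hint P n) (hint Q n)]
        simp [add_mul]
      have h2 : ∫ x, (P + Q) x = (∫ x, P x) + ∫ x, Q x := by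
        rw [← integral_add (integrable_of_continuous_torus P.continuous)
          (integrable_of_continuous_torus Q.continuous)]
        simp
      simp only [h1, h2]
      exact hP.add hQ
    | smul a P _ hP =>
      have h1 : ∀ n, ∫ x, (a • P) x * (g n x : ℂ) = a * ∫ x, P x * (g n x : ℂ) := by
        intro n
        rw [← integral_const_mul]
        simp [mul_assoc]
      have h2 : ∫ x, (a • P) x = a * ∫ x, P x := by
        rw [← integral_const_mul]
        simp
      simp only [h1, h2]
      exact hP.const_mul a
  have hF : F ∈ closure
      (Submodule.span ℂ (Set.range (UnitAddTorus.mFourier (d := Fin 2))) : Set _) := by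
    rw [← Submodule.topologicalClosure_coe, UnitAddTorus.span_mFourier_closure_eq_top]
    trivial
  rw [Metric.tendsto_atTop]
  intro ε hε
  obtain ⟨P, hP, hFP⟩ := Metric.mem_closure_iff.1 hF (ε / 3) (by positivity)
  obtain ⟨N, hN⟩ := Metric.tendsto_atTop.1 (hspan P hP) (ε / 3) (by positivity)
  have hnorm : ∀ x, ‖F x - P x‖ ≤ ε / 3 := fun x => by
    rw [← dist_eq_norm]
    exact (ContinuousMap.dist_apply_le_dist x).trans hFP.le
  refine ⟨N, fun n hn => ?_⟩
  have h1 : dist (∫ x, F x * (g n x : ℂ)) (∫ x, P x * (g n x : ℂ)) ≤ ε / 3 := by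
    rw [dist_eq_norm, ← integral_sub (hint F n) (hint P n)]
    calc ‖∫ x, (F x * (g n x : ℂ) - P x * (g n x : ℂ))‖
        ≤ ∫ x, ε / 3 * g n x := by
          refine norm_integral_le_of_norm_le
            ((integrable_of_continuous_torus (hg n)).const_mul _) (ae_of_all _ fun x => ?_)
          rw [← sub_mul, norm_mul, Complex.norm_real, Real.norm_eq_abs, abs_of_nonneg (hg0 n x)]
          exact mul_le_mul_of_nonneg_right (hnorm x) (hg0 n x)
      _ = ε / 3 := by rw [integral_const_mul, hg1, mul_one]
  have h2 : dist (∫ x, P x) (∫ x, F x) ≤ ε / 3 := by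
    rw [dist_comm, dist_eq_norm, ← integral_sub (integrable_of_continuous_torus F.continuous)
      (integrable_of_continuous_torus P.continuous)]
    refine (norm_integral_le_of_norm_le_const (ae_of_all _ hnorm)).trans ?_
    simp
  calc dist (∫ x, F x * (g n x : ℂ)) (∫ x, F x)
      ≤ dist (∫ x, F x * (g n x : ℂ)) (∫ x, P x * (g n x : ℂ)) +
        dist (∫ x, P x * (g n x : ℂ)) (∫ x, P x) + dist (∫ x, P x) (∫ x, F x) :=
        dist_triangle4 _ _ _ _
    _ < ε := by linarith [hN n hn]

/-- Weak convergence of densities on the torus gives weak convergence of their periodic lifts. -/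
theorem tendsto_integral_mul_torusMk_of_fourier {g : ℕ → (Fin 2 → UnitAddCircle) → ℝ}
    (hg : ∀ n, Continuous (g n)) (hg0 : ∀ n x, 0 ≤ g n x) (hg1 : ∀ n, ∫ x, g n x = 1)
    (hcoef : ∀ m : Fin 2 → ℤ, m ≠ 0 →
      Tendsto (fun n => ∫ x, UnitAddTorus.mFourier m x * (g n x : ℂ)) atTop (𝓝 0))
    {φ : (Fin 2 → ℝ) → ℝ} (hφ : Continuous φ) (hφc : HasCompactSupport φ) :
    Tendsto (fun n => ∫ x, φ x * g n (torusMk x)) atTop (𝓝 (∫ x, φ x)) := by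
  obtain ⟨F, hF⟩ := exists_periodization (φ := fun x => (φ x : ℂ))
    (Complex.continuous_ofReal.comp hφ) (hφc.comp_left (g := ((↑) : ℝ → ℂ)) Complex.ofReal_zero)
  have h1 := tendsto_integral_mul_of_fourier hg hg0 hg1 hcoef F
  have h2 := hF (fun _ => 1) continuous_const
  simp only [mul_one] at h2
  rw [← h2, integral_complex_ofReal] at h1
  have h3 : ∀ n, ∫ x, F x * (g n x : ℂ) = ((∫ x, φ x * g n (torusMk x) : ℝ) : ℂ) := by
    intro n
    rw [← hF (fun x => (g n x : ℂ)) (Complex.continuous_ofReal.comp (hg n)),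
      ← integral_complex_ofReal]
    simp
  simp only [h3] at h1
  exact (Complex.continuous_re.tendsto _).comp h1

end Periodization

/-! ### Tent functions -/

section Tent

/-- The tent function on the torus of height `1`, supported in the ball of radius `ρ` around `z`. -/
def tent (z : Fin 2 → UnitAddCircle) (ρ : ℝ) (x : Fin 2 → UnitAddCircle) : ℝ :=
  max 0 (1 - dist x z / ρ)

variable {z : Fin 2 → UnitAddCircle} {ρ : ℝ} {x y : Fin 2 → UnitAddCircle}

theorem continuous_tent (z : Fin 2 → UnitAddCircle) (ρ : ℝ) : Continuous (tent z ρ) := by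
  unfold tent; fun_prop

theorem tent_nonneg (z : Fin 2 → UnitAddCircle) (ρ : ℝ) (x : Fin 2 → UnitAddCircle) :
    0 ≤ tent z ρ x := le_max_left _ _

theorem tent_le_one (hρ : 0 < ρ) : tent z ρ x ≤ 1 :=
  max_le zero_le_one (by have : 0 ≤ dist x z / ρ := by positivity
                         linarith)

theorem tent_eq_zero (hρ : 0 < ρ) (h : ρ ≤ dist x z) : tent z ρ x = 0 := by
  have : 1 ≤ dist x z / ρ := (one_le_div hρ).2 h
  exact max_eq_left (by linarith)

theorem abs_tent_sub_le (hρ : 0 < ρ) : |tent z ρ x - tent z ρ y| ≤ dist x y / ρ := by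
  rw [tent, tent, max_comm 0, max_comm 0]
  refine (abs_max_sub_max_le_abs _ _ _).trans ?_
  rw [sub_sub_sub_cancel_left, ← sub_div, abs_div, abs_of_pos hρ, abs_sub_comm]
  exact div_le_div_of_nonneg_right (abs_dist_sub_le x y z) hρ.le

theorem volume_closedBall_torus (z : Fin 2 → UnitAddCircle) (hρ : 0 ≤ ρ) :
    volume.real (Metric.closedBall z ρ) = min 1 (2 * ρ) ^ 2 := by
  rw [measureReal_def, volume_pi_closedBall _ hρ]
  simp only [AddCircle.volume_closedBall, Finset.prod_const, Finset.card_univ, Fintype.card_fin,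
    ENNReal.toReal_pow]
  rw [ENNReal.toReal_ofReal (le_min zero_le_one (by positivity))]

theorem sq_div_two_le_integral_tent (z : Fin 2 → UnitAddCircle) (hρ : 0 < ρ) (hρ1 : ρ ≤ 1) :
    ρ ^ 2 / 2 ≤ ∫ x, tent z ρ x := by
  have hb := volume_closedBall_torus z (half_pos hρ).le
  rw [mul_div_cancel₀ _ two_ne_zero, min_eq_right hρ1] at hb
  calc ρ ^ 2 / 2 = ∫ x, (Metric.closedBall z (ρ / 2)).indicator (fun _ => (1 / 2 : ℝ)) x := by
        rw [integral_indicator_const _ Metric.isClosed_closedBall.measurableSet, hb, smul_eq_mul]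
        ring
    _ ≤ ∫ x, tent z ρ x := by
        refine integral_mono_of_nonneg (ae_of_all _ fun x => ?_)
          (integrable_of_continuous_torus (continuous_tent z ρ)) (ae_of_all _ fun x => ?_)
        · exact indicator_nonneg (fun _ _ => by norm_num) x
        · by_cases hx : x ∈ Metric.closedBall z (ρ / 2)
          · rw [indicator_of_mem hx]
            have : dist x z / ρ ≤ 1 / 2 := by
              rw [div_le_iff₀ hρ]; have := Metric.mem_closedBall.1 hx; linarith
            exact le_max_of_le_right (by linarith)
          · rw [indicator_of_notMem hx]
            exact tent_nonneg _ _ _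

theorem integral_tent_pos (z : Fin 2 → UnitAddCircle) (hρ : 0 < ρ) (hρ1 : ρ ≤ 1) :
    0 < ∫ x, tent z ρ x :=
  lt_of_lt_of_le (by positivity) (sq_div_two_le_integral_tent z hρ hρ1)

/-- Translation by `w` moves the tent function by `O(ρ ‖w‖)` in `L¹`. -/
theorem integral_abs_tent_add_sub_le (z w : Fin 2 → UnitAddCircle) (hρ : 0 < ρ) :
    ∫ x, |tent z ρ x - tent z ρ (x + w)| ≤ 8 * ρ * dist w 0 := by
  have hball : ∫ x, (Metric.closedBall z ρ).indicator (fun _ => (1 : ℝ)) x ≤ 4 * ρ ^ 2 := by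
    rw [integral_indicator_const _ Metric.isClosed_closedBall.measurableSet,
      volume_closedBall_torus z hρ.le, smul_eq_mul, mul_one]
    have : min 1 (2 * ρ) ^ 2 ≤ (2 * ρ) ^ 2 :=
      pow_le_pow_left₀ (le_min zero_le_one (by positivity)) (min_le_right _ _) 2
    linarith
  set χ : (Fin 2 → UnitAddCircle) → ℝ :=
    (Metric.closedBall z ρ).indicator (fun _ => (1 : ℝ)) with hχ
  have hχi : Integrable χ := (integrable_const 1).indicator Metric.isClosed_closedBall.measurableSet
  have hχ' : ∫ x, χ (x + w) = ∫ x, χ x := integral_add_right_eq_self χ w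
  calc ∫ x, |tent z ρ x - tent z ρ (x + w)|
      ≤ ∫ x, dist w 0 / ρ * (χ x + χ (x + w)) := by
        refine integral_mono_of_nonneg (ae_of_all _ fun x => abs_nonneg _)
          ((hχi.add (hχi.comp_add_right w)).const_mul _) (ae_of_all _ fun x => ?_)
        have hχ0 : ∀ x, 0 ≤ χ x := fun x => indicator_nonneg (fun _ _ => zero_le_one) x
        have hd : 0 ≤ dist w 0 / ρ := by positivity
        have hone : ∀ x ∈ Metric.closedBall z ρ, χ x = 1 := fun x hx => indicator_of_mem hx _
        have hzero : ∀ x ∉ Metric.closedBall z ρ, tent z ρ x = 0 := fun x hx =>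
          tent_eq_zero hρ (by rw [Metric.mem_closedBall, not_le] at hx; exact hx.le)
        by_cases hx : x ∈ Metric.closedBall z ρ ∨ x + w ∈ Metric.closedBall z ρ
        · have h1 : 1 ≤ χ x + χ (x + w) := by
            rcases hx with hx | hx
            · rw [hone _ hx]; linarith [hχ0 (x + w)]
            · rw [hone _ hx]; linarith [hχ0 x]
          have h2 : |tent z ρ x - tent z ρ (x + w)| ≤ dist w 0 / ρ := by
            refine (abs_tent_sub_le hρ).trans_eq ?_
            rw [dist_eq_norm, dist_eq_norm, sub_add_cancel_left, norm_neg, sub_zero]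
          exact h2.trans (le_mul_of_one_le_right hd h1)
        · push Not at hx
          dsimp only
          rw [hzero _ hx.1, hzero _ hx.2, sub_self, abs_zero]
          exact mul_nonneg hd (add_nonneg (hχ0 _) (hχ0 _))
    _ = dist w 0 / ρ * (2 * ∫ x, χ x) := by
        rw [integral_const_mul, integral_add hχi (hχi.comp_add_right w), hχ']; ring
    _ ≤ dist w 0 / ρ * (2 * (4 * ρ ^ 2)) := by gcongr
    _ = _ := by field_simp; ring

end Tent

/-! ### Equidistribution of the pulled back tents -/

section Equidistribution

variable {A : Matrix (Fin 2) (Fin 2) ℤ} {a₁ a₂ : ℝ}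

/-- The endomorphism of the torus induced by an integer matrix. -/
def torusHom (A : Matrix (Fin 2) (Fin 2) ℤ) :
    (Fin 2 → UnitAddCircle) →+ (Fin 2 → UnitAddCircle) where
  toFun x := fun i => ∑ j, A i j • x j
  map_zero' := by funext i; simp
  map_add' x y := by funext i; simp [Finset.sum_add_distrib]

theorem continuous_torusHom : Continuous (torusHom A) := by
  change Continuous fun (x : Fin 2 → UnitAddCircle) i => ∑ j, A i j • x j
  fun_prop

theorem torusHom_torusMk (x : Fin 2 → ℝ) : torusHom A (torusMk x) = torusMk (realMulVec A x) := by
  funext i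
  change ∑ j, A i j • ((x j : ℝ) : UnitAddCircle) = ((∑ j, (A i j : ℝ) * x j : ℝ) : UnitAddCircle)
  simp only [Fin.sum_univ_two, AddCircle.coe_add, ← zsmul_eq_mul, AddCircle.coe_zsmul]

theorem torusHom_iterate_torusMk (n : ℕ) (x : Fin 2 → ℝ) :
    (torusHom A)^[n] (torusMk x) = torusMk ((realMulVec A)^[n] x) := by
  induction n generalizing x with
  | zero => rfl
  | succ n ih => simp only [Function.iterate_succ, Function.comp_apply, torusHom_torusMk, ih]

theorem realMulVec_surjective (hA : A.det ≠ 0) : Function.Surjective (realMulVec A) := by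
  intro y
  have hd : (A 0 0 * A 1 1 - A 0 1 * A 1 0 : ℝ) ≠ 0 := by
    rw [Matrix.det_fin_two] at hA
    exact_mod_cast hA
  refine ⟨![(A 1 1 * y 0 - A 0 1 * y 1) / (A 0 0 * A 1 1 - A 0 1 * A 1 0),
    (A 0 0 * y 1 - A 1 0 * y 0) / (A 0 0 * A 1 1 - A 0 1 * A 1 0)], funext fun i => ?_⟩
  fin_cases i
  · simp [realMulVec, Fin.sum_univ_two]
    field_simp
    ring
  · simp [realMulVec, Fin.sum_univ_two]
    rw [← mul_div_assoc, ← mul_div_assoc, ← add_div, div_eq_iff hd]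
    ring

theorem measurePreserving_torusHom_iterate (hA : A.det ≠ 0) (n : ℕ) :
    MeasurePreserving (torusHom A)^[n] volume volume := by
  refine MeasurePreserving.iterate (AddMonoidHom.measurePreserving continuous_torusHom ?_ rfl) n
  intro y
  obtain ⟨v, rfl⟩ := torusMk_surjective y
  obtain ⟨u, rfl⟩ := realMulVec_surjective hA v
  exact ⟨torusMk u, torusHom_torusMk u⟩

theorem integral_comp_torusHom_iterate (hA : A.det ≠ 0) (n : ℕ)
    {f : (Fin 2 → UnitAddCircle) → ℝ} (hf : Continuous f) :
    ∫ x, f ((torusHom A)^[n] x) = ∫ x, f x := by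
  have h := measurePreserving_torusHom_iterate hA n
  rw [← integral_map (φ := (torusHom A)^[n]) h.measurable.aemeasurable hf.aestronglyMeasurable,
    h.map_eq]

theorem torusHom_iterate_add (n : ℕ) (x y : Fin 2 → UnitAddCircle) :
    (torusHom A)^[n] (x + y) = (torusHom A)^[n] x + (torusHom A)^[n] y :=
  iterate_map_add (torusHom A) n x y

/-- The normalized tent densities at the target, pulled back under the `n`-th iterate. -/
def tentDensity (A : Matrix (Fin 2) (Fin 2) ℤ) (n : ℕ) (z : Fin 2 → UnitAddCircle) (ρ : ℝ)
    (x : Fin 2 → UnitAddCircle) : ℝ :=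
  tent z ρ ((torusHom A)^[n] x) / ∫ x, tent z ρ x

theorem continuous_tentDensity (n : ℕ) (z : Fin 2 → UnitAddCircle) (ρ : ℝ) :
    Continuous (tentDensity A n z ρ) :=
  ((continuous_tent z ρ).comp (continuous_torusHom.iterate n)).div_const _

theorem tentDensity_nonneg (n : ℕ) (z : Fin 2 → UnitAddCircle) (ρ : ℝ) (x : Fin 2 → UnitAddCircle) :
    0 ≤ tentDensity A n z ρ x :=
  div_nonneg (tent_nonneg _ _ _) (integral_nonneg fun _ => tent_nonneg _ _ _)

theorem integral_tentDensity (hA : A.det ≠ 0) (n : ℕ) (z : Fin 2 → UnitAddCircle) {ρ : ℝ}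
    (hρ : 0 < ρ) (hρ1 : ρ ≤ 1) : ∫ x, tentDensity A n z ρ x = 1 := by
  unfold tentDensity
  rw [integral_div, integral_comp_torusHom_iterate hA n (continuous_tent z ρ),
    div_self (integral_tent_pos z hρ hρ1).ne']

/-- The adjoint relation between the iterates of `A` and of its transpose. -/
theorem realMulVec_transpose_iterate (n : ℕ) (q x : Fin 2 → ℝ) :
    ∑ i, (realMulVec A.transpose)^[n] q i * x i = ∑ i, q i * (realMulVec A)^[n] x i := by
  induction n generalizing q x with
  | zero => rfl
  | succ n ih =>
    rw [Function.iterate_succ', Function.iterate_succ, Function.comp_apply, Function.comp_apply,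
      ← ih]
    simp only [realMulVec, Fin.sum_univ_two, Matrix.transpose_apply]
    ring

/-- If `|det A| ≥ 2`, a given nontrivial character is nontrivial on the kernel of `T^n` for large
`n`: otherwise it would be the pullback under `T^n` of another character, and then its quadratic
form `eigenform_mul` would be divisible by `det A ^ n`. -/
theorem IsHyperbolicPair.eventually_exists_kernel (h : IsHyperbolicPair A a₁ a₂)
    (hA : 2 ≤ |A.det|) {m : Fin 2 → ℤ} (hm : m ≠ 0) :
    ∀ᶠ n in atTop, ∃ y, (torusHom A)^[n] y = 0 ∧ UnitAddTorus.mFourier m y ≠ 1 := by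
  have hdet : 2 ≤ |a₁ * a₂| := by rw [h.abs_mul_eq]; exact_mod_cast hA
  set N := |eigenform A.transpose a₁ (fun i => m i) * eigenform A.transpose a₂ (fun i => m i)|
  have hlim : Tendsto (fun n : ℕ => |a₁ * a₂| ^ n) atTop atTop :=
    tendsto_pow_atTop_atTop_of_one_lt (by linarith)
  filter_upwards [hlim.eventually_gt_atTop N] with n hn
  by_contra! hcon
  have hsurj := (realMulVec_surjective h.det_ne_zero).iterate n
  have hq : ∀ x : Fin 2 → ℝ, ∀ k : Fin 2 → ℤ, (realMulVec A)^[n] x = (fun i => (k i : ℝ)) →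
      ∃ q : ℤ, m 0 * x 0 + m 1 * x 1 = q := by
    intro x k hk
    rw [← mFourier_torusMk_eq_one_iff]
    refine hcon _ ?_
    rw [torusHom_iterate_torusMk, hk, torusMk_intCast]
  obtain ⟨x₀, hx₀⟩ := hsurj ![1, 0]
  obtain ⟨x₁, hx₁⟩ := hsurj ![0, 1]
  obtain ⟨q₀, hq₀⟩ := hq x₀ ![1, 0] (by rw [hx₀]; funext i; fin_cases i <;> simp)
  obtain ⟨q₁, hq₁⟩ := hq x₁ ![0, 1] (by rw [hx₁]; funext i; fin_cases i <;> simp)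
  obtain ⟨q, hqm⟩ := (realMulVec_surjective (A := A.transpose)
    (by rw [Matrix.det_transpose]; exact h.det_ne_zero)).iterate n fun i => (m i : ℝ)
  have hqi : q = fun i => ((![q₀, q₁] i : ℤ) : ℝ) := by
    have e₀ := realMulVec_transpose_iterate (A := A) n q x₀
    have e₁ := realMulVec_transpose_iterate (A := A) n q x₁
    rw [hqm, hx₀, Fin.sum_univ_two, Fin.sum_univ_two, hq₀] at e₀
    rw [hqm, hx₁, Fin.sum_univ_two, Fin.sum_univ_two, hq₁] at e₁
    funext i
    fin_cases i
    · simpa using e₀.symm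
    · simpa using e₁.symm
  have hq0 : ![q₀, q₁] ≠ 0 := by
    intro h0
    rw [h0] at hqi
    have h1 := realMulVec_iterate_sub (A := A.transpose) n 0 0
    rw [sub_self, sub_self] at h1
    rw [show q = 0 by rw [hqi]; funext i; simp, h1] at hqm
    refine hm (funext fun i => ?_)
    have := congrFun hqm i
    simp only [Pi.zero_apply] at this ⊢
    exact_mod_cast this.symm
  have h1 := h.transpose.one_le_abs_eigenform_mul hq0
  rw [← hqi] at h1
  have h2 : N = |a₁ * a₂| ^ n * |eigenform A.transpose a₁ q * eigenform A.transpose a₂ q| := by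
    simp only [N]
    rw [← hqm, eigenform_iterate h.transpose.sq_left, eigenform_iterate h.transpose.sq_right,
      ← abs_pow, ← abs_mul]
    congr 1
    ring
  have h3 : |a₁ * a₂| ^ n * 1 ≤ N := by
    rw [h2]
    exact mul_le_mul_of_nonneg_left h1 (by positivity)
  linarith

/-- The contracting eigendirection is irrational: no nontrivial character is trivial on it. -/
theorem IsHyperbolicPair.exists_eigenvector (h : IsHyperbolicPair A a₁ a₂) {m : Fin 2 → ℤ}
    (hm : m ≠ 0) : ∃ v : Fin 2 → ℝ, realMulVec A v = a₁ • v ∧ m 0 * v 0 + m 1 * v 1 = 1 / 2 := by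
  have hc : (A 1 0 : ℝ) ≠ 0 := by exact_mod_cast h.entry_ne_zero
  set s := m 0 * (a₂ - A 0 0) - m 1 * A 1 0 with hs
  have hs0 : s ≠ 0 := by
    intro h0
    by_cases hm0 : m 0 = 0
    · refine hm (funext fun i => ?_)
      have hm1 : m 1 = 0 := by simpa [hs, hm0, h.entry_ne_zero] using h0
      fin_cases i
      · exact hm0
      · exact hm1
    · have hm0' : (m 0 : ℝ) ≠ 0 := by exact_mod_cast hm0
      refine h.right_ne_rat (A 0 0 + m 1 * A 1 0 / m 0) ?_
      push_cast
      field_simp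
      linarith
  have h1 := h.add
  have h2 := h.mul
  refine ⟨![(a₂ - A 0 0) / (2 * s), -A 1 0 / (2 * s)], funext fun i => ?_, ?_⟩
  · fin_cases i
    · simp only [realMulVec, Fin.sum_univ_two, Fin.zero_eta, Matrix.cons_val_zero,
        Matrix.cons_val_one, Pi.smul_apply, smul_eq_mul]
      rw [← mul_div_assoc, ← mul_div_assoc, ← mul_div_assoc, ← add_div]
      congr 1
      linear_combination A 0 0 * h1 - h2
    · simp only [realMulVec, Fin.sum_univ_two, Fin.mk_one, Matrix.cons_val_zero,
        Matrix.cons_val_one, Pi.smul_apply, smul_eq_mul]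
      rw [← mul_div_assoc, ← mul_div_assoc, ← mul_div_assoc, ← add_div]
      congr 1
      linear_combination A 1 0 * h1
  · simp only [Matrix.cons_val_zero, Matrix.cons_val_one]
    field_simp
    linarith

theorem realMulVec_iterate_eigenvector {v : Fin 2 → ℝ} {a : ℝ} (hv : realMulVec A v = a • v)
    (n : ℕ) : (realMulVec A)^[n] v = a ^ n • v := by
  induction n with
  | zero => simp
  | succ n ih =>
    rw [Function.iterate_succ', Function.comp_apply, ih, pow_succ, mul_smul, ← hv]
    funext i
    simp only [realMulVec, Pi.smul_apply, smul_eq_mul, Finset.mul_sum]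
    exact Finset.sum_congr rfl fun j _ => by ring

/-- The nontrivial Fourier coefficients of the normalized tent densities tend to zero. If
`|det A| ≥ 2` they eventually vanish, because the densities are invariant under the kernel of `T^n`.
If `τ < -l₁`, the density at time `n` is almost invariant under translation along the contracting
direction, since the target is much larger than the contraction factor `|a₁| ^ n`. -/
theorem IsHyperbolicPair.tendsto_fourier (h : IsHyperbolicPair A a₁ a₂) {τ : ℝ} (hτ : 0 < τ)
    (hcase : 2 ≤ |A.det| ∨ τ < -Real.log |a₁|) (z : ℕ → Fin 2 → UnitAddCircle)
    {m : Fin 2 → ℤ} (hm : m ≠ 0) :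
    Tendsto (fun n => ∫ x, UnitAddTorus.mFourier m x *
      (tentDensity A n (z n) (Real.exp (-(n * τ)) / 2) x : ℂ)) atTop (𝓝 0) := by
  rcases hcase with hdet | hlt
  · refine tendsto_const_nhds.congr' ?_
    filter_upwards [h.eventually_exists_kernel hdet hm] with n hn
    obtain ⟨y, hy0, hy1⟩ := hn
    refine (integral_mFourier_mul_eq_zero hy1 fun x => ?_).symm
    rw [tentDensity, tentDensity, torusHom_iterate_add, hy0, add_zero]
  · obtain ⟨v, hv, hmv⟩ := h.exists_eigenvector hm
    have hy : UnitAddTorus.mFourier m (torusMk v) = -1 := by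
      rw [mFourier_torusMk, hmv]
      rw [show (2 * Real.pi * Complex.I * ((1 / 2 : ℝ) : ℂ)) = Real.pi * Complex.I by
        push_cast; ring, Complex.exp_pi_mul_I]
    set ρ : ℕ → ℝ := fun n => Real.exp (-(n * τ)) / 2 with hρ
    have hρ0 : ∀ n, 0 < ρ n := fun n => by positivity
    have hρ1 : ∀ n, ρ n ≤ 1 := fun n => by
      have : Real.exp (-(n * τ)) ≤ 1 := Real.exp_le_one_iff.2 (by
        have : 0 ≤ n * τ := by positivity
        linarith)
      simp only [hρ]; linarith
    have hbound : ∀ n, ‖∫ x, UnitAddTorus.mFourier m x * (tentDensity A n (z n) (ρ n) x : ℂ)‖ ≤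
        16 * ‖v‖ * (|a₁| * Real.exp τ) ^ n := by
      intro n
      set g := tentDensity A n (z n) (ρ n) with hg
      have hgc : Continuous g := continuous_tentDensity n _ _
      have hgc' : Continuous fun x => (g x : ℂ) := Complex.continuous_ofReal.comp hgc
      have hgt : Continuous fun x => (g (x + torusMk v) : ℂ) :=
        hgc'.comp (continuous_add_const _)
      have hm' : Continuous (UnitAddTorus.mFourier m) := (UnitAddTorus.mFourier m).continuous
      have e1 : ∫ x, UnitAddTorus.mFourier m x * (g x : ℂ) =
          -∫ x, UnitAddTorus.mFourier m x * (g (x + torusMk v) : ℂ) := by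
        rw [← integral_add_right_eq_self (μ := (volume : Measure (Fin 2 → UnitAddCircle)))
          (fun x => UnitAddTorus.mFourier m x * (g x : ℂ)) (torusMk v), ← integral_neg]
        simp only [mFourier_apply_add, hy]
        congr 1
        funext x
        ring
      have e2 : 2 * ∫ x, UnitAddTorus.mFourier m x * (g x : ℂ) =
          ∫ x, UnitAddTorus.mFourier m x * ((g x : ℂ) - (g (x + torusMk v) : ℂ)) := by
        have i1 : Integrable fun x => UnitAddTorus.mFourier m x * (g x : ℂ) :=
          integrable_of_continuous_torus (hm'.mul hgc')
        have i2 : Integrable fun x => UnitAddTorus.mFourier m x * (g (x + torusMk v) : ℂ) :=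
          integrable_of_continuous_torus (hm'.mul hgt)
        simp only [mul_sub]
        rw [integral_sub i1 i2, two_mul]
        nth_rewrite 2 [e1]
        ring
      have e3 : ‖2 * ∫ x, UnitAddTorus.mFourier m x * (g x : ℂ)‖ ≤
          ∫ x, |g x - g (x + torusMk v)| := by
        rw [e2]
        refine norm_integral_le_of_norm_le (integrable_of_continuous_torus
          (hgc.sub (hgc.comp (continuous_add_const _))).abs) (ae_of_all _ fun x => ?_)
        rw [norm_mul, norm_mFourier_apply, one_mul, ← Complex.ofReal_sub, Complex.norm_real,
          Real.norm_eq_abs]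
      set w := (torusHom A)^[n] (torusMk v) with hw
      set I := ∫ x, tent (z n) (ρ n) x with hI
      have hI0 : 0 < I := integral_tent_pos _ (hρ0 n) (hρ1 n)
      have e4 : ∫ x, |g x - g (x + torusMk v)| =
          (∫ x, |tent (z n) (ρ n) x - tent (z n) (ρ n) (x + w)|) / I := by
        have ht := continuous_tent (z n) (ρ n)
        rw [← integral_comp_torusHom_iterate h.det_ne_zero n
          (f := fun x => |tent (z n) (ρ n) x - tent (z n) (ρ n) (x + w)|)
          (ht.sub (ht.comp (continuous_add_const _))).abs, ← integral_div]
        congr 1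
        funext x
        rw [hg, tentDensity, tentDensity, ← sub_div, abs_div, abs_of_pos hI0, torusHom_iterate_add]
      have e5 : dist w 0 ≤ |a₁| ^ n * ‖v‖ := by
        rw [hw, torusHom_iterate_torusMk, realMulVec_iterate_eigenvector hv,
          show (0 : Fin 2 → UnitAddCircle) = torusMk 0 from funext fun i => rfl]
        refine (dist_torusMk_le _ _).trans_eq ?_
        rw [sub_zero, norm_smul, norm_pow, Real.norm_eq_abs]
      have e6 : (∫ x, |tent (z n) (ρ n) x - tent (z n) (ρ n) (x + w)|) / I ≤
          2 * (16 * ‖v‖ * (|a₁| * Real.exp τ) ^ n) := by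
        rw [div_le_iff₀ hI0]
        have hI2 := sq_div_two_le_integral_tent (z n) (hρ0 n) (hρ1 n)
        have hexp : ρ n * Real.exp τ ^ n = 1 / 2 := by
          simp only [hρ]
          rw [← Real.exp_nat_mul, div_mul_eq_mul_div, ← Real.exp_add, neg_add_cancel, Real.exp_zero]
        calc _ ≤ 8 * ρ n * dist w 0 := integral_abs_tent_add_sub_le _ _ (hρ0 n)
          _ ≤ 8 * ρ n * (|a₁| ^ n * ‖v‖) := by
              have := hρ0 n
              gcongr
          _ = 2 * (16 * ‖v‖ * (|a₁| * Real.exp τ) ^ n) * (ρ n ^ 2 / 2) := by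
              rw [mul_pow]
              linear_combination (-16 * ρ n * |a₁| ^ n * ‖v‖) * hexp
          _ ≤ _ := by gcongr
      rw [norm_mul, Complex.norm_ofNat] at e3
      rw [e4] at e3
      linarith
    refine squeeze_zero_norm hbound ?_
    have hlt' : |a₁| * Real.exp τ < 1 := by
      calc |a₁| * Real.exp τ < |a₁| * Real.exp (-Real.log |a₁|) :=
            mul_lt_mul_of_pos_left (Real.exp_lt_exp.2 hlt) h.pos
        _ = 1 := by rw [Real.exp_neg, Real.exp_log h.pos, mul_inv_cancel₀ h.pos.ne']
    have := (tendsto_pow_atTop_nhds_zero_of_lt_one (by positivity) hlt').const_mul (16 * ‖v‖)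
    rwa [mul_zero] at this

end Equidistribution

/-! ### Similarity transformations -/

section Similarity

/-- A similarity multiplies Lebesgue integrals by a positive constant. -/
theorem exists_integral_comp_dilationEquiv
    (f : EuclideanSpace ℝ (Fin 2) ≃ᵈ EuclideanSpace ℝ (Fin 2)) :
    ∃ c : ℝ, 0 < c ∧ ∀ F : EuclideanSpace ℝ (Fin 2) → ℝ, ∫ x, F (f x) = c * ∫ x, F x := by
  set r : ℝ := ((Dilation.ratio f : ℝ≥0) : ℝ) with hr
  have hr0 : 0 < r := by exact_mod_cast Dilation.ratio_pos f
  let g : EuclideanSpace ℝ (Fin 2) ≃ᵢ EuclideanSpace ℝ (Fin 2) := IsometryEquiv.mk'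
    (fun x => r⁻¹ • f x) (fun x => f.symm (r • x))
    (fun x => by simp [smul_smul, hr0.ne']) (Isometry.of_dist_eq fun x y => by
      rw [dist_smul₀, Dilation.dist_eq, Real.norm_eq_abs, abs_of_pos (inv_pos.2 hr0), ← mul_assoc,
        ← hr, inv_mul_cancel₀ hr0.ne', one_mul])
  have hg : MeasurePreserving g volume volume := by
    have := g.measurePreserving_euclideanHausdorffMeasure 2
    rwa [EuclideanSpace.euclideanHausdorffMeasure_eq_volume] at this
  refine ⟨|(r ^ Module.finrank ℝ (EuclideanSpace ℝ (Fin 2)))⁻¹|, by positivity, fun F => ?_⟩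
  have h1 : ∀ x, f x = r • g x := fun x => by
    change f x = r • r⁻¹ • f x
    rw [smul_smul, mul_inv_cancel₀ hr0.ne', one_smul]
  simp only [h1]
  rw [hg.integral_comp g.toHomeomorph.measurableEmbedding (fun x => F (r • x)),
    Measure.integral_comp_smul, smul_eq_mul]

variable {s : ℝ} {ψ : ℕ → EuclideanSpace ℝ (Fin 2) → ℝ}

/-- The image of a Frostman sequence under a similarity is a Frostman sequence. -/
theorem IsFrostmanSequence.comp_dilationEquiv_symm (hψ : IsFrostmanSequence volume s ψ)
    (f : EuclideanSpace ℝ (Fin 2) ≃ᵈ EuclideanSpace ℝ (Fin 2)) :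
    IsFrostmanSequence volume s fun n x => ψ n (f.symm x) := by
  obtain ⟨c, hc, hint⟩ := exists_integral_comp_dilationEquiv f.symm
  have hcf : Continuous f := f.toHomeomorph.continuous
  have hcs : Continuous f.symm := f.toHomeomorph.symm.continuous
  set q : ℝ := ((Dilation.ratio f.symm : ℝ≥0) : ℝ) with hq
  have hq0 : 0 < q := by exact_mod_cast Dilation.ratio_pos f.symm
  refine ⟨fun n => (hψ.continuous n).comp hcs, fun n x => hψ.nonneg n _, fun R => ?_,
    fun φ hφ hφc => ?_⟩
  · obtain ⟨C, hC⟩ := hψ.frostman (q * R)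
    refine ⟨c * C * q ^ s, fun n x r hr hrR => ?_⟩
    rw [← integral_indicator Metric.isClosed_closedBall.measurableSet]
    have h1 : ∀ y, (Metric.closedBall x r).indicator (fun y => ψ n (f.symm y)) y =
        (Metric.closedBall (f.symm x) (q * r)).indicator (ψ n) (f.symm y) := by
      intro y
      have : y ∈ Metric.closedBall x r ↔ f.symm y ∈ Metric.closedBall (f.symm x) (q * r) := by
        rw [Metric.mem_closedBall, Metric.mem_closedBall, Dilation.dist_eq, ← hq,
          mul_le_mul_iff_right₀ hq0]
      by_cases hy : y ∈ Metric.closedBall x r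
      · rw [indicator_of_mem hy, indicator_of_mem (this.1 hy)]
      · rw [indicator_of_notMem hy, indicator_of_notMem (mt this.2 hy)]
    simp only [h1]
    rw [hint, integral_indicator Metric.isClosed_closedBall.measurableSet]
    calc _ ≤ c * (C * (q * r) ^ s) :=
          mul_le_mul_of_nonneg_left (hC n _ _ (by positivity) (by gcongr)) hc.le
      _ = _ := by rw [Real.mul_rpow hq0.le hr.le]; ring
  · have h1 : ∀ n, ∫ x, φ x * ψ n (f.symm x) = c * ∫ x, φ (f x) * ψ n x := by
      intro n
      rw [← hint]
      simp
    have h2 : ∫ x, φ x = c * ∫ x, φ (f x) := by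
      rw [← hint]
      simp
    simp only [h1, h2]
    exact (hψ.tendsto (fun x => φ (f x)) (hφ.comp hcf)
      (hφc.comp_homeomorph f.toHomeomorph)).const_mul c

end Similarity

/-! ### The Frostman sequence of the targets -/

section LowerBound

variable {A : Matrix (Fin 2) (Fin 2) ℤ} {a₁ a₂ : ℝ}

/-- The quotient map from the Euclidean plane to the torus with its supremum metric. -/
def planeMk (x : EuclideanSpace ℝ (Fin 2)) : Fin 2 → UnitAddCircle := torusMk (WithLp.ofLp x)

theorem continuous_planeMk : Continuous planeMk :=
  continuous_torusMk.comp (PiLp.continuous_ofLp 2 _)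

/-- The normalized tent densities at the targets, pulled back under the iterates of `T` and lifted
to the plane, form a Frostman sequence. -/
theorem IsHyperbolicPair.isFrostmanSequence (h : IsHyperbolicPair A a₁ a₂) {τ : ℝ} (hτ : 0 < τ)
    (hcase : 2 ≤ |A.det| ∨ τ < -Real.log |a₁|) (z : ℕ → Fin 2 → UnitAddCircle) :
    IsFrostmanSequence (volume : Measure (EuclideanSpace ℝ (Fin 2)))
      (targetDim (Real.log |a₁|) (Real.log |a₂|) τ)
      fun n x => tentDensity A n (z n) (Real.exp (-(n * τ)) / 2) (planeMk x) := by
  set s := targetDim (Real.log |a₁|) (Real.log |a₂|) τ with hs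
  set ρ : ℕ → ℝ := fun n => Real.exp (-(n * τ)) / 2 with hρ
  have hρ0 : ∀ n, 0 < ρ n := fun n => by positivity
  have hρ1 : ∀ n, ρ n ≤ 1 := fun n => by
    have : Real.exp (-(n * τ)) ≤ 1 := Real.exp_le_one_iff.2 (by
      have : 0 ≤ n * τ := by positivity
      linarith)
    simp only [hρ]; linarith
  have hofLp := PiLp.volume_preserving_ofLp (Fin 2)
  have hemb : MeasurableEmbedding (WithLp.ofLp : EuclideanSpace ℝ (Fin 2) → Fin 2 → ℝ) :=
    (MeasurableEquiv.toLp 2 (Fin 2 → ℝ)).symm.measurableEmbedding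
  have hcont : ∀ n, Continuous fun x => tentDensity A n (z n) (ρ n) (torusMk x) := fun n =>
    (continuous_tentDensity n _ _).comp continuous_torusMk
  refine ⟨fun n => (continuous_tentDensity n _ _).comp continuous_planeMk,
    fun n x => tentDensity_nonneg _ _ _ _, fun R => ?_, fun φ hφ hφc => ?_⟩
  · obtain ⟨C, hC, hvol⟩ := h.exists_volume_inter_le_rpow hτ (show (0 : ℝ) < 1 / 2 by norm_num)
    rw [← hs] at hvol
    refine ⟨8 * C * (R ^ (2 - s) + 1), fun n x r hr hrR => ?_⟩
    have hR : 0 < R := hr.trans_le hrR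
    set I := ∫ x, tent (z n) (ρ n) x with hI
    have hI0 : 0 < I := integral_tent_pos _ (hρ0 n) (hρ1 n)
    set B := Metric.closedBall (WithLp.ofLp x) r with hB
    set T := targetPreimage A n (z n) (ρ n) with hT
    have hsub : Metric.closedBall x r ⊆ WithLp.ofLp ⁻¹' B := by
      intro y hy
      refine Metric.mem_closedBall.2 ((dist_pi_le_iff hr.le).2 fun i => ?_)
      refine le_trans ?_ (Metric.mem_closedBall.1 hy)
      rw [dist_eq_norm, dist_eq_norm]
      exact PiLp.norm_apply_le (y - x) i
    have hBT : MeasurableSet (B ∩ T) :=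
      (Metric.isClosed_closedBall.inter (isClosed_targetPreimage _ _ _)).measurableSet
    have hBTfin : volume (B ∩ T) ≠ ∞ :=
      ((measure_mono inter_subset_left).trans_lt
        (isCompact_closedBall _ _).measure_lt_top).ne
    have hle : ∀ y, tentDensity A n (z n) (ρ n) (torusMk y) ≤ T.indicator (fun _ => I⁻¹) y := by
      intro y
      rw [tentDensity, torusHom_iterate_torusMk, ← hI, div_eq_mul_inv]
      by_cases hy : y ∈ T
      · rw [indicator_of_mem hy]
        exact mul_le_of_le_one_left (inv_nonneg.2 hI0.le) (tent_le_one (hρ0 n))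
      · rw [indicator_of_notMem hy, tent_eq_zero (hρ0 n) (not_le.1 hy).le, zero_mul]
    have hvolBT : volume.real (B ∩ T) ≤ C * Real.exp (-(n * τ)) ^ 2 * (r ^ 2 + r ^ s) := by
      refine ENNReal.toReal_le_of_le_ofReal (by positivity) ?_
      have := hvol n (z n) (WithLp.ofLp x) r hr
      rwa [show 1 / 2 * Real.exp (-(n * τ)) = ρ n by simp only [hρ]; ring] at this
    calc ∫ y in Metric.closedBall x r, tentDensity A n (z n) (ρ n) (planeMk y)
        ≤ ∫ y in WithLp.ofLp ⁻¹' B, tentDensity A n (z n) (ρ n) (planeMk y) := by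
          refine setIntegral_mono_set ?_ (ae_of_all _ fun y => tentDensity_nonneg _ _ _ _)
            (Eventually.of_forall hsub)
          refine (hofLp.integrableOn_comp_preimage hemb
            (f := fun v => tentDensity A n (z n) (ρ n) (torusMk v))).2 ?_
          exact (hcont n).continuousOn.integrableOn_compact (isCompact_closedBall _ _)
      _ = ∫ y in B, tentDensity A n (z n) (ρ n) (torusMk y) :=
          hofLp.setIntegral_preimage_emb hemb
            (fun v => tentDensity A n (z n) (ρ n) (torusMk v)) B
      _ ≤ ∫ y in B, T.indicator (fun _ => I⁻¹) y := by
          refine setIntegral_mono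
            ((hcont n).continuousOn.integrableOn_compact (isCompact_closedBall _ _)) ?_ hle
          refine IntegrableOn.indicator ?_ (isClosed_targetPreimage _ _ _).measurableSet
          exact integrableOn_const (isCompact_closedBall _ _).measure_lt_top.ne
      _ = volume.real (B ∩ T) * I⁻¹ := by
          rw [setIntegral_indicator (isClosed_targetPreimage _ _ _).measurableSet,
            setIntegral_const, smul_eq_mul]
      _ ≤ (C * Real.exp (-(n * τ)) ^ 2 * (r ^ 2 + r ^ s)) * (ρ n ^ 2 / 2)⁻¹ := by
          have := hρ0 n
          have := sq_div_two_le_integral_tent (z n) (hρ0 n) (hρ1 n)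
          gcongr
      _ = 8 * C * (r ^ 2 + r ^ s) := by
          simp only [hρ]
          field_simp
          norm_num
      _ ≤ 8 * C * (R ^ (2 - s) * r ^ s + r ^ s) := by
          have hs2 := targetDim_le_two h.log_neg h.log_add_log_nonneg hτ
          rw [← hs] at hs2
          have e : r ^ 2 = r ^ (2 - s) * r ^ s := by
            rw [← Real.rpow_add hr, sub_add_cancel]; simp
          rw [e]
          have : r ^ (2 - s) ≤ R ^ (2 - s) := Real.rpow_le_rpow hr.le hrR (by linarith)
          gcongr
      _ = _ := by ring
  · have h1 := tendsto_integral_mul_torusMk_of_fourier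
      (fun n => continuous_tentDensity (A := A) n (z n) (ρ n))
      (fun n x => tentDensity_nonneg n (z n) (ρ n) x)
      (fun n => integral_tentDensity h.det_ne_zero n (z n) (hρ0 n) (hρ1 n))
      (fun m hm => h.tendsto_fourier hτ hcase z hm)
      (φ := fun v => φ (WithLp.toLp 2 v)) (hφ.comp (PiLp.continuous_toLp 2 _))
      (hφc.comp_homeomorph (PiLp.homeomorph 2 fun _ : Fin 2 => ℝ).symm)
    have h2 : ∫ x, φ x = ∫ v : Fin 2 → ℝ, φ (WithLp.toLp 2 v) :=
      hofLp.integral_comp hemb (fun v => φ (WithLp.toLp 2 v))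
    have h3 : ∀ n, ∫ x, φ x * tentDensity A n (z n) (ρ n) (planeMk x) =
        ∫ v : Fin 2 → ℝ, φ (WithLp.toLp 2 v) * tentDensity A n (z n) (ρ n) (torusMk v) := fun n =>
      hofLp.integral_comp hemb
        (fun v => φ (WithLp.toLp 2 v) * tentDensity A n (z n) (ρ n) (torusMk v))
    rw [h2]
    exact h1.congr fun n => (h3 n).symm

end LowerBound

/-! ### The upper bound for the dimension -/

section UpperBound

theorem ediam_closedBall_le_ofReal {X : Type*} [MetricSpace X] (x : X) (r : ℝ) :
    Metric.ediam (Metric.closedBall x r) ≤ ENNReal.ofReal (2 * r) := by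
  refine Metric.ediam_le fun y hy w hw => ?_
  rw [edist_dist]
  refine ENNReal.ofReal_le_ofReal ?_
  have := dist_triangle_right y w x
  rw [Metric.mem_closedBall] at hy hw
  linarith

/-- If `S n` is covered by `O(e^{nα})` balls of radius `O(e^{-nβ})`, then the upper limit of the
sets `S n` has Hausdorff dimension at most `α / β`. -/
theorem dimH_limsup_le {X : Type*} [MetricSpace X] {S : ℕ → Set X} {α β C D : ℝ}
    (hα : 0 ≤ α) (hβ : 0 < β) (hD : 0 < D)
    (hS : ∀ n : ℕ, ∃ F : Finset X, (F.card : ℝ) ≤ C * Real.exp (n * α) ∧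
      S n ⊆ ⋃ x ∈ F, Metric.closedBall x (D * Real.exp (-(n * β)))) :
    dimH {x | ∃ᶠ n in atTop, x ∈ S n} ≤ ENNReal.ofReal (α / β) := by
  borelize X
  choose F hcard hcov using hS
  refine le_of_forall_gt_imp_ge_of_dense fun c hc => ?_
  obtain ⟨d, hd1, hd2⟩ := ENNReal.lt_iff_exists_nnreal_btwn.1 hc
  refine le_trans ?_ hd2.le
  have hd : α / β < d := by
    rw [← ENNReal.ofReal_coe_nnreal] at hd1
    exact (ENNReal.ofReal_lt_ofReal_iff'.1 hd1).1
  have hd0 : (0 : ℝ) < d := lt_of_le_of_lt (by positivity) hd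
  refine dimH_le_of_hausdorffMeasure_ne_top (ne_top_of_le_ne_top ?_
    (Measure.hausdorffMeasure_le_liminf_tsum (β := ℕ) (ι := fun N => Σ k : ℕ, F (N + k)) d _
      (l := atTop)
      (fun N => ENNReal.ofReal (2 * (D * Real.exp (-(N * β))))) ?_
      (fun N i => Metric.closedBall (i.2 : X) (D * Real.exp (-((N + i.1 : ℕ) * β)))) ?_ ?_))
  · -- the sums are bounded by a convergent geometric series
    set q := Real.exp (α - β * d) with hq
    have hq1 : q < 1 := Real.exp_lt_one_iff.2 (by rw [div_lt_iff₀ hβ] at hd; linarith)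
    have hC : 0 ≤ C := by
      have := (Nat.cast_nonneg _).trans (hcard 0)
      simpa using this
    have hbound : ∀ N : ℕ, ∑' i : Σ k : ℕ, F (N + k), Metric.ediam
        (Metric.closedBall (i.2 : X) (D * Real.exp (-((N + i.1 : ℕ) * β)))) ^ (d : ℝ) ≤
        ENNReal.ofReal (C * (2 * D) ^ (d : ℝ) * (1 - q)⁻¹) := by
      intro N
      rw [ENNReal.tsum_sigma']
      have hinner : ∀ k, ∑' x : F (N + k), Metric.ediam
          (Metric.closedBall (x : X) (D * Real.exp (-((N + k : ℕ) * β)))) ^ (d : ℝ) ≤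
          ENNReal.ofReal (C * (2 * D) ^ (d : ℝ) * q ^ k) := by
        intro k
        have h1 : ∀ x : F (N + k), Metric.ediam
            (Metric.closedBall (x : X) (D * Real.exp (-((N + k : ℕ) * β)))) ^ (d : ℝ) ≤
            ENNReal.ofReal ((2 * (D * Real.exp (-((N + k : ℕ) * β)))) ^ (d : ℝ)) := by
          intro x
          rw [← ENNReal.ofReal_rpow_of_nonneg (by positivity) hd0.le]
          refine ENNReal.rpow_le_rpow ?_ hd0.le
          exact ediam_closedBall_le_ofReal _ _
        refine (ENNReal.tsum_le_tsum h1).trans ?_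
        rw [tsum_fintype, Finset.sum_const, Finset.card_univ, Fintype.card_coe, nsmul_eq_mul,
          ← ENNReal.ofReal_natCast, ← ENNReal.ofReal_mul (Nat.cast_nonneg _)]
        refine ENNReal.ofReal_le_ofReal ?_
        calc ((F (N + k)).card : ℝ) * (2 * (D * Real.exp (-((N + k : ℕ) * β)))) ^ (d : ℝ)
            ≤ (C * Real.exp ((N + k : ℕ) * α)) *
              (2 * (D * Real.exp (-((N + k : ℕ) * β)))) ^ (d : ℝ) := by
              gcongr
              exact hcard _
          _ = C * (2 * D) ^ (d : ℝ) * q ^ (N + k) := by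
              rw [← mul_assoc, Real.mul_rpow (by positivity) (Real.exp_pos _).le, ← Real.exp_mul,
                hq, ← Real.exp_nat_mul,
                show ((N + k : ℕ) : ℝ) * (α - β * d) =
                  (N + k : ℕ) * α + -((N + k : ℕ) * β) * d by ring, Real.exp_add]
              ring
          _ ≤ C * (2 * D) ^ (d : ℝ) * q ^ k := by
              refine mul_le_mul_of_nonneg_left ?_ (by positivity)
              exact pow_le_pow_of_le_one (Real.exp_pos _).le hq1.le (Nat.le_add_left k N)
      refine (ENNReal.tsum_le_tsum hinner).trans ?_
      have hsum := summable_geometric_of_lt_one (Real.exp_pos _).le hq1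
      rw [← ENNReal.ofReal_tsum_of_nonneg (fun k => by positivity) (hsum.mul_left _), tsum_mul_left,
        tsum_geometric_of_lt_one (Real.exp_pos _).le hq1]
    refine ne_top_of_le_ne_top ENNReal.ofReal_ne_top 
      (b := ENNReal.ofReal (C * (2 * D) ^ (d : ℝ) * (1 - q)⁻¹)) ?_
    exact (liminf_le_limsup).trans (limsup_le_of_le (h := Eventually.of_forall hbound))
  · have h1 : Tendsto (fun N : ℕ => 2 * (D * Real.exp (-(N * β)))) atTop (𝓝 0) := by
      have h2 : Tendsto (fun N : ℕ => -((N : ℝ) * β)) atTop atBot :=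
        tendsto_neg_atTop_atBot.comp (tendsto_natCast_atTop_atTop.atTop_mul_const hβ)
      simpa using ((Real.tendsto_exp_atBot.comp h2).const_mul D).const_mul 2
    simpa using ENNReal.tendsto_ofReal h1
  · refine Eventually.of_forall fun N i => ?_
    have h1 : D * Real.exp (-((N + i.1 : ℕ) * β)) ≤ D * Real.exp (-(N * β)) := by
      gcongr
      exact Nat.le_add_right _ _
    refine (Metric.ediam_mono (Metric.closedBall_subset_closedBall h1)).trans ?_
    exact ediam_closedBall_le_ofReal _ _
  · refine Eventually.of_forall fun N x hx => ?_
    obtain ⟨n, hn, hxn⟩ := frequently_atTop.1 hx N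
    obtain ⟨k, rfl⟩ := Nat.exists_eq_add_of_le hn
    obtain ⟨y, hy, hxy⟩ := mem_iUnion₂.1 (hcov _ hxn)
    exact mem_iUnion.2 ⟨⟨k, y, hy⟩, hxy⟩

/-- A set whose separated subsets have bounded cardinality is covered by that number of balls. -/
theorem exists_finset_cover_of_separated {X : Type*} [MetricSpace X] {S : Set X} {ε N : ℝ}
    (hε : 0 ≤ ε)
    (hN : ∀ F : Finset X, (F : Set X) ⊆ S → (∀ x ∈ F, ∀ y ∈ F, x ≠ y → ε < dist x y) →
      (F.card : ℝ) ≤ N) :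
    ∃ F : Finset X, (F.card : ℝ) ≤ N ∧ S ⊆ ⋃ x ∈ F, Metric.closedBall x ε := by
  classical
  let P : Finset X → Prop := fun F =>
    (F : Set X) ⊆ S ∧ ∀ x ∈ F, ∀ y ∈ F, x ≠ y → ε < dist x y
  have hbdd : BddAbove {n | ∃ F, P F ∧ F.card = n} := by
    refine ⟨⌊N⌋₊, ?_⟩
    rintro n ⟨F, hF, rfl⟩
    exact Nat.le_floor (hN F hF.1 hF.2)
  have hne : {n | ∃ F, P F ∧ F.card = n}.Nonempty := ⟨0, ∅, ⟨by simp, by simp⟩, rfl⟩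
  obtain ⟨F, hF, hFc⟩ := Nat.sSup_mem hne hbdd
  refine ⟨F, hN F hF.1 hF.2, fun x hx => ?_⟩
  by_contra hcon
  simp only [mem_iUnion, Metric.mem_closedBall, not_exists, not_le] at hcon
  by_cases hxF : x ∈ F
  · have := hcon x hxF
    rw [dist_self] at this
    linarith
  · have hins : P (insert x F) := by
      refine ⟨by rw [Finset.coe_insert]; exact insert_subset hx hF.1, fun y hy w hw hyw => ?_⟩
      obtain hy | hy := Finset.mem_insert.1 hy <;> obtain hw | hw := Finset.mem_insert.1 hw
      · exact absurd (hy.trans hw.symm) hyw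
      · rw [hy]; exact hcon w hw
      · rw [hw, dist_comm]; exact hcon y hy
      · exact hF.2 y hy w hw hyw
    have := le_csSup hbdd ⟨_, hins, rfl⟩
    rw [← hFc, Finset.card_insert_of_notMem hxF] at this
    omega

variable {A : Matrix (Fin 2) (Fin 2) ℤ} {a₁ a₂ : ℝ}

/-- The part of `targetPreimage` in the unit ball is covered by `O(e^{n(max l l₁ + max l l₂)})`
balls of radius `O(e^{-n(τ + l)})`: around each point of a separated set there is a parallelogram
contained in a slightly larger `targetPreimage`, of which the total area is known. -/
theorem IsHyperbolicPair.exists_cover (h : IsHyperbolicPair A a₁ a₂) {τ l : ℝ} (hτ : 0 < τ)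
    (hl : 0 ≤ τ + l) : ∃ C D : ℝ, 0 < D ∧ ∀ (n : ℕ) (z : Fin 2 → UnitAddCircle),
      ∃ F : Finset (Fin 2 → ℝ),
        (F.card : ℝ) ≤ C * Real.exp (n * (max l (Real.log |a₁|) + max l (Real.log |a₂|))) ∧
        Metric.closedBall 0 1 ∩ targetPreimage A n z (Real.exp (-(n * τ))) ⊆
          ⋃ x ∈ F, Metric.closedBall x (D * Real.exp (-(n * (τ + l)))) := by
  obtain ⟨L, hL, -, -, hL'⟩ := h.exists_bound
  obtain ⟨C, hC, hvol⟩ := h.exists_volume_inter_le_rpow hτ (show 0 < 1 + L by linarith)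
  set s := targetDim (Real.log |a₁|) (Real.log |a₂|) τ
  set q := |A 1 0 * (a₂ - a₁)| with hq
  have hq0 : 0 < q := abs_pos.2 (mul_ne_zero (by exact_mod_cast h.entry_ne_zero)
    (sub_ne_zero.2 h.left_ne_right.symm))
  refine ⟨q / 4 * (C * ((1 + L) ^ 2 + (1 + L) ^ s)), L * 2, by positivity, fun n z =>
    exists_finset_cover_of_separated (by positivity) fun F hF hsep => ?_⟩
  set l₁ := Real.log |a₁| with hl₁
  set l₂ := Real.log |a₂| with hl₂
  have hexp₁ : |a₁ ^ n| = Real.exp (n * l₁) := by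
    rw [Real.exp_nat_mul, hl₁, Real.exp_log h.pos, abs_pow]
  have hexp₂ : |a₂ ^ n| = Real.exp (n * l₂) := by
    rw [Real.exp_nat_mul, hl₂, Real.exp_log (one_pos.trans h.one_lt), abs_pow]
  set t₁ := Real.exp (-(n * (τ + max l l₁))) with ht₁
  set t₂ := Real.exp (-(n * (τ + max l l₂))) with ht₂
  set δ := Real.exp (-(n * (τ + l))) with hδ
  have hn : (0 : ℝ) ≤ n := Nat.cast_nonneg n
  have hδ1 : δ ≤ 1 := Real.exp_le_one_iff.2 (by have := mul_nonneg hn hl; linarith)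
  have ht₁δ : t₁ ≤ δ := by
    simp only [ht₁, hδ]; gcongr; exact le_max_left _ _
  have ht₂δ : t₂ ≤ δ := by
    simp only [ht₂, hδ]; gcongr; exact le_max_left _ _
  have ht₁ρ : |a₁ ^ n| * t₁ ≤ Real.exp (-(n * τ)) := by
    rw [hexp₁, ht₁, ← Real.exp_add, Real.exp_le_exp]
    have := mul_le_mul_of_nonneg_left (le_max_right l l₁) hn
    linarith
  have ht₂ρ : |a₂ ^ n| * t₂ ≤ Real.exp (-(n * τ)) := by
    rw [hexp₂, ht₂, ← Real.exp_add, Real.exp_le_exp]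
    have := mul_le_mul_of_nonneg_left (le_max_right l l₂) hn
    linarith
  let box : (Fin 2 → ℝ) → Set (Fin 2 → ℝ) := fun x => {y |
    |eigenform A a₁ y - eigenform A a₁ x| ≤ t₁ ∧ |eigenform A a₂ y - eigenform A a₂ x| ≤ t₂}
  have hboxm : ∀ x, MeasurableSet (box x) := fun x =>
    ((isClosed_le ((continuous_eigenform a₁).sub continuous_const).abs continuous_const).inter
      (isClosed_le ((continuous_eigenform a₂).sub continuous_const).abs
        continuous_const)).measurableSet
  have hdisj : (F : Set (Fin 2 → ℝ)).PairwiseDisjoint box := by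
    intro x hx y hy hxy
    refine Set.disjoint_left.2 fun w hwx hwy => ?_
    have h1 := hsep x hx y hy hxy
    rw [dist_eq_norm] at h1
    have h2 : ‖x - y‖ ≤ L * (2 * δ) := by
      refine hL' _ _ ?_ ?_
      · rw [eigenform_sub]
        have e1 := abs_le.1 hwx.1
        have e2 := abs_le.1 hwy.1
        rw [abs_le]; constructor <;> linarith
      · rw [eigenform_sub]
        have e1 := abs_le.1 hwx.2
        have e2 := abs_le.1 hwy.2
        rw [abs_le]; constructor <;> linarith
    linarith
  have hsub : ⋃ x ∈ F, box x ⊆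
      Metric.closedBall 0 (1 + L) ∩ targetPreimage A n z ((1 + L) * Real.exp (-(n * τ))) := by
    refine iUnion₂_subset fun x hx y hy => ?_
    obtain ⟨hx1, hx2⟩ := hF hx
    constructor
    · have e1 : ‖y - x‖ ≤ L * 1 := by
        refine hL' _ _ ?_ ?_
        · rw [eigenform_sub]; exact hy.1.trans (ht₁δ.trans hδ1)
        · rw [eigenform_sub]; exact hy.2.trans (ht₂δ.trans hδ1)
      rw [mem_closedBall_zero_iff] at hx1 ⊢
      have := norm_le_norm_add_norm_sub' y x
      linarith
    · have e1 : ‖(realMulVec A)^[n] y - (realMulVec A)^[n] x‖ ≤ L * Real.exp (-(n * τ)) := by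
        rw [← realMulVec_iterate_sub]
        refine hL' _ _ ?_ ?_
        · rw [eigenform_iterate h.sq_left, abs_mul, eigenform_sub]
          exact (mul_le_mul_of_nonneg_left hy.1 (abs_nonneg _)).trans ht₁ρ
        · rw [eigenform_iterate h.sq_right, abs_mul, eigenform_sub]
          exact (mul_le_mul_of_nonneg_left hy.2 (abs_nonneg _)).trans ht₂ρ
      refine (dist_triangle _ _ _).trans
        (add_le_add ((dist_torusMk_le _ _).trans e1) hx2 |>.trans_eq ?_)
      ring
  have hmeas := (measure_mono hsub).trans (hvol n z 0 (1 + L) (by linarith))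
  rw [measure_biUnion_finset hdisj fun x _ => hboxm x] at hmeas
  have hbox : ∀ x, volume (box x) = ENNReal.ofReal (4 * t₁ * t₂ / q) := fun x =>
    h.volume_box _ _ (Real.exp_pos _).le
  simp_rw [hbox] at hmeas
  rw [Finset.sum_const, nsmul_eq_mul, ← ENNReal.ofReal_natCast,
    ← ENNReal.ofReal_mul (Nat.cast_nonneg _), ENNReal.ofReal_le_ofReal_iff (by positivity)] at hmeas
  have hE : Real.exp (-(n * τ)) ^ 2 = t₁ * t₂ * Real.exp (n * (max l l₁ + max l l₂)) := by
    simp only [ht₁, ht₂]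
    rw [← Real.exp_nat_mul, ← Real.exp_add, ← Real.exp_add]
    congr 1; push_cast; ring
  rw [hE] at hmeas
  have ht : 0 < t₁ * t₂ := by positivity
  refine le_of_mul_le_mul_right ?_ (show 0 < 4 * (t₁ * t₂) / q by positivity)
  calc (F.card : ℝ) * (4 * (t₁ * t₂) / q) = F.card * (4 * t₁ * t₂ / q) := by ring
    _ ≤ _ := hmeas
    _ = _ := by field_simp

/-- The points of the unit ball of the plane that hit the targets infinitely often. -/
theorem IsHyperbolicPair.dimH_limsup_targetPreimage_le (h : IsHyperbolicPair A a₁ a₂) {τ l : ℝ}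
    (hτ : 0 < τ) (hl : 0 < τ + l) (hpos : 0 ≤ max l (Real.log |a₁|) + max l (Real.log |a₂|))
    (z : ℕ → Fin 2 → UnitAddCircle) :
    dimH {x : Fin 2 → ℝ | ∃ᶠ n : ℕ in atTop,
      x ∈ Metric.closedBall 0 1 ∩ targetPreimage A n (z n) (Real.exp (-(n * τ)))} ≤
    ENNReal.ofReal ((max l (Real.log |a₁|) + max l (Real.log |a₂|)) / (τ + l)) := by
  obtain ⟨C, D, hD, hcov⟩ := h.exists_cover hτ hl.le
  exact dimH_limsup_le hpos hl hD fun n => hcov n (z n)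

end UpperBound

/-! ### The torus with the Euclidean distance -/

section EuclideanTorus

variable {A : Matrix (Fin 2) (Fin 2) ℤ} {a₁ a₂ : ℝ}

/-- The eigenvalues are real: two complex conjugate ones would have the same modulus. -/
theorem exists_isHyperbolicPair {lam₁ lam₂ : ℂ}
    (hA : (A.map (Int.castRingHom ℂ)).charpoly.roots = {lam₁, lam₂})
    (h₀ : 0 < ‖lam₁‖) (h₁ : ‖lam₁‖ < 1) (h₂ : 1 < ‖lam₂‖) :
    ∃ a₁ a₂ : ℝ, IsHyperbolicPair A a₁ a₂ ∧ ‖lam₁‖ = |a₁| ∧ ‖lam₂‖ = |a₂| := by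
  have htr : ((A 0 0 + A 1 1 : ℤ) : ℂ) = lam₁ + lam₂ := by
    have := Matrix.trace_eq_sum_roots_charpoly (A.map (Int.castRingHom ℂ))
    rw [hA, Matrix.trace_fin_two] at this
    simpa using this
  have hdet : ((A 0 0 * A 1 1 - A 0 1 * A 1 0 : ℤ) : ℂ) = lam₁ * lam₂ := by
    have := Matrix.det_eq_prod_roots_charpoly (A.map (Int.castRingHom ℂ))
    rw [hA, Matrix.det_fin_two] at this
    simpa using this
  have htr_re := congrArg Complex.re htr
  have htr_im := congrArg Complex.im htr
  have hdet_re := congrArg Complex.re hdet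
  have hdet_im := congrArg Complex.im hdet
  simp only [Complex.add_re, Complex.add_im, Complex.mul_re, Complex.mul_im, Complex.intCast_re,
    Complex.intCast_im] at htr_re htr_im hdet_re hdet_im
  have him : lam₁.im = 0 := by
    by_contra hne
    have hre : lam₂.re = lam₁.re := by
      have : lam₁.im * (lam₂.re - lam₁.re) = 0 := by linear_combination -hdet_im + lam₁.re * htr_im
      linarith [(mul_eq_zero.1 this).resolve_left hne]
    have hsq : ‖lam₁‖ ^ 2 = ‖lam₂‖ ^ 2 := by
      rw [Complex.sq_norm, Complex.sq_norm, Complex.normSq_apply, Complex.normSq_apply, hre,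
        show lam₂.im = -lam₁.im by linarith]
      ring
    nlinarith
  have him' : lam₂.im = 0 := by linarith
  have e₁ : lam₁ = (lam₁.re : ℂ) := Complex.ext rfl (by simpa using him)
  have e₂ : lam₂ = (lam₂.re : ℂ) := Complex.ext rfl (by simpa using him')
  have n₁ : ‖lam₁‖ = |lam₁.re| := by
    conv_lhs => rw [e₁]
    rw [Complex.norm_real, Real.norm_eq_abs]
  have n₂ : ‖lam₂‖ = |lam₂.re| := by
    conv_lhs => rw [e₂]
    rw [Complex.norm_real, Real.norm_eq_abs]
  refine ⟨lam₁.re, lam₂.re, ⟨?_, ?_, n₁ ▸ h₀, n₁ ▸ h₁, n₂ ▸ h₂⟩, n₁, n₂⟩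
  · push_cast at htr_re; linarith
  · rw [him, him'] at hdet_re
    push_cast at hdet_re; linarith

theorem ofLp_toralMap_iterate (n : ℕ) (x : Torus 2) :
    WithLp.ofLp ((toralMap A)^[n] x) = (torusHom A)^[n] (WithLp.ofLp x) :=
  Function.Semiconj.iterate_right (f := fun x : Torus 2 => WithLp.ofLp x) (fun _ => rfl) n x

theorem continuous_toralMap : Continuous (toralMap A) :=
  (PiLp.continuous_toLp 2 _).comp (continuous_torusHom.comp (PiLp.continuous_ofLp 2 _))

theorem continuous_torusProj : Continuous (Torus.proj : EuclideanSpace ℝ (Fin 2) → Torus 2) :=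
  (PiLp.continuous_toLp 2 _).comp continuous_planeMk

theorem dist_ofLp_le (x y : Torus 2) : dist (WithLp.ofLp x) (WithLp.ofLp y) ≤ dist x y := by
  simpa using (PiLp.lipschitzWith_ofLp 2 (fun _ : Fin 2 => UnitAddCircle)).dist_le_mul x y

/-- The Euclidean distance on the torus is less than twice a positive bound of the distances of
the coordinates. -/
theorem dist_lt_of_dist_ofLp_le {x y : Torus 2} {ρ : ℝ} (hρ : 0 < ρ)
    (h : dist (WithLp.ofLp x) (WithLp.ofLp y) ≤ ρ) : dist x y < 2 * ρ := by
  rw [PiLp.dist_eq_of_L2, Fin.sum_univ_two]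
  have h0 : dist (x 0) (y 0) ≤ ρ := (dist_le_pi_dist (WithLp.ofLp x) (WithLp.ofLp y) 0).trans h
  have h1 : dist (x 1) (y 1) ≤ ρ := (dist_le_pi_dist (WithLp.ofLp x) (WithLp.ofLp y) 1).trans h
  rw [Real.sqrt_lt' (by positivity)]
  have := pow_le_pow_left₀ dist_nonneg h0 2
  have := pow_le_pow_left₀ dist_nonneg h1 2
  nlinarith

theorem isGδ_preimage_shrinkingTargetSet (z : ℕ → Torus 2) (τ : ℝ) :
    IsGδ (Torus.proj ⁻¹' shrinkingTargetSet A z τ) := by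
  have : Torus.proj ⁻¹' shrinkingTargetSet A z τ = ⋂ N : ℕ, ⋃ n ≥ N,
      (fun x => (toralMap A)^[n] (Torus.proj x)) ⁻¹' Metric.ball (z n) (Real.exp (-(n * τ))) := by
    ext x
    simp [shrinkingTargetSet, frequently_atTop]
  rw [this]
  refine IsGδ.iInter_of_isOpen fun N => isOpen_biUnion fun n _ => ?_
  exact Metric.isOpen_ball.preimage ((continuous_toralMap.iterate n).comp continuous_torusProj)

/-- The projection of the plane to the torus is isometric on sets of diameter at most `1 / 2`, so
it does not decrease the Hausdorff dimension. -/
theorem dimH_preimage_torusProj_le (E : Set (Torus 2)) : dimH (Torus.proj ⁻¹' E) ≤ dimH E := by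
  by_contra! hlt
  obtain ⟨x, -, hx⟩ := exists_mem_nhdsWithin_lt_dimH_of_lt_dimH hlt
  set t := Torus.proj ⁻¹' E ∩ Metric.ball x (1 / 4) with ht
  have htE := hx t (inter_mem_nhdsWithin _ (Metric.ball_mem_nhds x (by norm_num)))
  have hiso : Isometry fun y : t => Torus.proj (y : EuclideanSpace ℝ (Fin 2)) := by
    refine Isometry.of_dist_eq fun y w => ?_
    rw [Subtype.dist_eq, PiLp.dist_eq_of_L2, EuclideanSpace.dist_eq]
    have hyw : dist (y : EuclideanSpace ℝ (Fin 2)) w ≤ 1 / 2 := by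
      have h1 := Metric.mem_ball.1 y.2.2
      have h2 := Metric.mem_ball.1 w.2.2
      have := dist_triangle_right (y : EuclideanSpace ℝ (Fin 2)) w x
      linarith
    congr 1
    refine Finset.sum_congr rfl fun i _ => ?_
    congr 1
    have hi : |y.1 i - w.1 i| ≤ 1 / 2 := by
      refine le_trans ?_ hyw
      rw [dist_eq_norm]
      exact PiLp.norm_apply_le (y.1 - w.1) i
    change dist ((y.1 i : ℝ) : UnitAddCircle) ((w.1 i : ℝ) : UnitAddCircle) = _
    rw [dist_eq_norm, ← AddCircle.coe_sub,
      (AddCircle.norm_coe_eq_abs_iff (p := 1) one_ne_zero).2 (by simpa using hi), Real.dist_eq]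
  have h1 := hiso.dimH_image univ
  have h2 : dimH (univ : Set t) = dimH t := by
    rw [← isometry_subtype_coe.dimH_image, image_univ, Subtype.range_coe]
  rw [h2] at h1
  rw [← h1] at htE
  refine absurd (dimH_mono ?_) (not_le.2 htE)
  rintro _ ⟨y, -, rfl⟩
  exact y.2.1

/-- The torus is a Lipschitz image of the unit ball of the plane. -/
theorem IsHyperbolicPair.dimH_shrinkingTargetSet_le (h : IsHyperbolicPair A a₁ a₂) {τ l : ℝ}
    (hτ : 0 < τ) (hl : 0 < τ + l) (hpos : 0 ≤ max l (Real.log |a₁|) + max l (Real.log |a₂|))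
    (z : ℕ → Torus 2) :
    dimH (shrinkingTargetSet A z τ) ≤
      ENNReal.ofReal ((max l (Real.log |a₁|) + max l (Real.log |a₂|)) / (τ + l)) := by
  refine le_trans ?_ (h.dimH_limsup_targetPreimage_le hτ hl hpos fun n => WithLp.ofLp (z n))
  have hlip : LipschitzWith 1 torusMk := LipschitzWith.of_dist_le_mul fun x y => by
    simpa [dist_eq_norm] using dist_torusMk_le x y
  refine le_trans (dimH_mono ?_)
    (((PiLp.lipschitzWith_toLp 2 fun _ : Fin 2 => UnitAddCircle).comp hlip).dimH_image_le _)
  intro x hx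
  obtain ⟨w, hw⟩ := torusMk_surjective (WithLp.ofLp x)
  set v : Fin 2 → ℝ := fun i => Int.fract (w i) with hv
  have hvw : torusMk v = WithLp.ofLp x := by
    rw [← hw, eq_comm, torusMk_eq_iff]
    exact ⟨fun i => ⌊w i⌋, funext fun i => (Int.fract_add_floor (w i)).symm⟩
  refine ⟨v, ?_, congrArg (WithLp.toLp 2) hvw⟩
  refine hx.mono fun n hn => ⟨?_, ?_⟩
  · rw [mem_closedBall_zero_iff, pi_norm_le_iff_of_nonneg zero_le_one]
    intro i
    rw [Real.norm_eq_abs, abs_of_nonneg (Int.fract_nonneg _)]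
    exact (Int.fract_lt_one _).le
  · change dist (torusMk _) _ ≤ _
    rw [← torusHom_iterate_torusMk, hvw, ← ofLp_toralMap_iterate]
    exact (dist_ofLp_le _ _).trans (Metric.mem_ball.1 hn).le

/-- The tent at radius `ρ / 2` in the supremum metric is supported in the open Euclidean ball of
radius `ρ`. -/
theorem tsupport_tentDensity_subset (n : ℕ) (z : Torus 2) {ρ : ℝ} (hρ : 0 < ρ)
    (f : EuclideanSpace ℝ (Fin 2) ≃ᵈ EuclideanSpace ℝ (Fin 2)) :
    tsupport (fun x => tentDensity A n (WithLp.ofLp z) (ρ / 2) (planeMk (f.symm x))) ⊆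
      f '' {x | (toralMap A)^[n] (Torus.proj x) ∈ Metric.ball z ρ} := by
  set K : Set (EuclideanSpace ℝ (Fin 2)) :=
    {x | dist ((torusHom A)^[n] (planeMk (f.symm x))) (WithLp.ofLp z) ≤ ρ / 2} with hK
  have hKc : IsClosed K := isClosed_le (((continuous_torusHom.iterate n).comp
    (continuous_planeMk.comp f.symm.toHomeomorph.continuous)).dist continuous_const)
    continuous_const
  have h1 : tsupport (fun x => tentDensity A n (WithLp.ofLp z) (ρ / 2) (planeMk (f.symm x))) ⊆
      K := by
    refine closure_minimal (fun x hx => ?_) hKc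
    by_contra hcon
    refine hx ?_
    change tent _ _ _ / _ = 0
    rw [tent_eq_zero (by positivity) (not_le.1 hcon).le, zero_div]
  refine h1.trans fun x hx => ⟨f.symm x, ?_, f.apply_symm_apply x⟩
  rw [mem_ofPred_eq, Metric.mem_ball]
  have := dist_lt_of_dist_ofLp_le (x := (toralMap A)^[n] (Torus.proj (f.symm x))) (y := z)
    (half_pos hρ) (by rw [ofLp_toralMap_iterate]; exact hx)
  linarith

/-- The normalized tents at the targets form a Frostman sequence, and so do their images under
similarities. -/
theorem IsHyperbolicPair.shrinkingTargetSet_mem (h : IsHyperbolicPair A a₁ a₂)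
    {τ : ℝ} (hτ : 0 < τ) (hcase : 2 ≤ |A.det| ∨ τ < -Real.log |a₁|) (z : ℕ → Torus 2) :
    shrinkingTargetSet A z τ ∈
      TorusLargeIntersectionClass 2 (targetDim (Real.log |a₁|) (Real.log |a₂|) τ) := by
  refine ⟨isGδ_preimage_shrinkingTargetSet z τ, fun f => ?_⟩
  refine (IsFrostmanSequence.le_dimH_iInter fun i =>
    (h.isFrostmanSequence hτ hcase fun n => WithLp.ofLp (z n)).comp_dilationEquiv_symm (f i)).trans
    (dimH_mono (iInter_mono fun i x hx => ?_))
  refine ⟨(f i).symm x, ?_, (f i).apply_symm_apply x⟩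
  refine (show ∃ᶠ n : ℕ in atTop, _ from hx).mono fun n hn => ?_
  obtain ⟨y, hy, hyx⟩ := tsupport_tentDensity_subset n (z n) (Real.exp_pos _) (f i) hn
  rwa [← hyx, (f i).symm_apply_apply]

/-- Membership in the large intersection class bounds the dimension of the set from below, by
taking all similarities equal to the identity. -/
theorem le_dimH_of_mem_torusLargeIntersectionClass {E : Set (Torus 2)} {s : ℝ}
    (hE : E ∈ TorusLargeIntersectionClass 2 s) : ENNReal.ofReal s ≤ dimH E := by
  refine ((hE.2 fun _ => DilationEquiv.refl _).trans (dimH_mono ?_)).trans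
    (dimH_preimage_torusProj_le E)
  intro x hx
  obtain ⟨y, hy, rfl⟩ := mem_iInter.1 hx 0
  exact hy

/-- The two bounds coincide at `τ = l₂`: the second minus the first has the sign of
`(l₂ - l₁) (τ - l₂)`. -/
theorem min_eq_targetDim {l₁ l₂ τ : ℝ} (h₁ : l₁ < 0) (h₂ : 0 < l₂) (hτ : -l₁ < τ) :
    min ((l₁ + l₂) / (τ + l₁)) (2 * l₂ / (τ + l₂)) = targetDim l₁ l₂ τ := by
  have e1 : 0 < τ + l₁ := by linarith
  have e2 : 0 < τ + l₂ := by linarith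
  unfold targetDim
  split_ifs with h
  · refine min_eq_right ?_
    rw [div_le_div_iff₀ e2 e1]
    nlinarith [mul_nonneg (show 0 ≤ l₂ - l₁ by linarith) (sub_nonneg.2 h)]
  · refine min_eq_left ?_
    rw [div_le_div_iff₀ e1 e2]
    nlinarith [mul_nonneg (show 0 ≤ l₂ - l₁ by linarith) (sub_nonneg.2 (not_le.1 h).le)]

/-- If `|det A| = 1` then `l₁ + l₂ = 0`, and the class of index zero contains the set for trivial
reasons. -/
theorem IsHyperbolicPair.shrinkingTargetSet_mem_of_lt (h : IsHyperbolicPair A a₁ a₂)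
    {τ : ℝ} (hτ : -Real.log |a₁| < τ) (z : ℕ → Torus 2) :
    shrinkingTargetSet A z τ ∈
      TorusLargeIntersectionClass 2 (targetDim (Real.log |a₁|) (Real.log |a₂|) τ) := by
  have hneg := h.log_neg
  by_cases hdet : 2 ≤ |A.det|
  · exact h.shrinkingTargetSet_mem (by linarith) (Or.inl hdet) z
  · have h1 : |A.det| = 1 := le_antisymm (by omega) (Int.one_le_abs h.det_ne_zero)
    have h2 := h.log_add_log
    rw [← Int.cast_abs, h1, Int.cast_one, Real.log_one] at h2
    have h3 : targetDim (Real.log |a₁|) (Real.log |a₂|) τ = 0 := by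
      rw [targetDim, if_neg (by linarith), h2, zero_div]
    rw [h3]
    exact ⟨isGδ_preimage_shrinkingTargetSet z τ, fun f => by simp⟩

end EuclideanTorus

end

theorem theorem1 (A : Matrix (Fin 2) (Fin 2) ℤ) (lam₁ lam₂ : ℂ)
    (hA : (A.map (Int.castRingHom ℂ)).charpoly.roots = {lam₁, lam₂})
    (h₀ : 0 < ‖lam₁‖) (h₁ : ‖lam₁‖ < 1) (h₂ : 1 < ‖lam₂‖)
    (l₁ l₂ : ℝ) (hl₁ : l₁ = Real.log ‖lam₁‖) (hl₂ : l₂ = Real.log ‖lam₂‖)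
    (z : ℕ → Torus 2) (τ : ℝ) :
    (0 < τ → τ < -l₁ →
      dimH (shrinkingTargetSet A z τ) = ENNReal.ofReal (2 * l₂ / (τ + l₂)) ∧
      shrinkingTargetSet A z τ ∈ TorusLargeIntersectionClass 2 (2 * l₂ / (τ + l₂))) ∧
    (-l₁ < τ →
      dimH (shrinkingTargetSet A z τ) =
        ENNReal.ofReal (min ((l₁ + l₂) / (τ + l₁)) (2 * l₂ / (τ + l₂))) ∧
      shrinkingTargetSet A z τ ∈
        TorusLargeIntersectionClass 2 (min ((l₁ + l₂) / (τ + l₁)) (2 * l₂ / (τ + l₂)))) := by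
  obtain ⟨a₁, a₂, h, ha₁, ha₂⟩ := exists_isHyperbolicPair hA h₀ h₁ h₂
  rw [ha₁] at hl₁
  rw [ha₂] at hl₂
  have hneg : l₁ < 0 := hl₁ ▸ h.log_neg
  have hsum : 0 ≤ l₁ + l₂ := by rw [hl₁, hl₂]; exact h.log_add_log_nonneg
  have hpos : 0 < l₂ := by linarith
  have hup : 0 < τ → dimH (shrinkingTargetSet A z τ) ≤ ENNReal.ofReal (2 * l₂ / (τ + l₂)) := by
    intro hτ
    have := h.dimH_shrinkingTargetSet_le (l := l₂) hτ (by linarith)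
    rw [← hl₁, ← hl₂, max_eq_left (by linarith), max_self, ← two_mul] at this
    exact this (by linarith) z
  constructor
  · intro hτ hτ₁
    have hmem := h.shrinkingTargetSet_mem hτ (Or.inr (hl₁ ▸ hτ₁)) z
    rw [← hl₁, ← hl₂, targetDim, if_pos (by linarith)] at hmem
    exact ⟨(hup hτ).antisymm (le_dimH_of_mem_torusLargeIntersectionClass hmem), hmem⟩
  · intro hτ₁
    have hmem := h.shrinkingTargetSet_mem_of_lt (hl₁ ▸ hτ₁) z
    rw [← hl₁, ← hl₂, ← min_eq_targetDim hneg hpos hτ₁] at hmem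
    refine ⟨le_antisymm ?_ (le_dimH_of_mem_torusLargeIntersectionClass hmem), hmem⟩
    rw [ENNReal.ofReal_min]
    refine le_min ?_ (hup (by linarith))
    have := h.dimH_shrinkingTargetSet_le (τ := τ) (l := l₁) (by linarith) (by linarith)
    rw [← hl₁, ← hl₂, max_self, max_eq_right (by linarith)] at this
    exact this hsum z
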